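/- **Model.** A model instance consists of positive integers $m,n,K$ with $K\le\min\{m,n\}$, numbers $p_{ij}\in[0,1]$ for $1\le i<j\le\max\{m,n\}$, and numbers $\varrho_{ij}\in[0,1]$ for $1\le i<j\le K$. Correlated Bernoulli random graphs $(G,H)$ with these parameters are random simple graphs $G$ on $[m]=\{1,\dots,m\}$ and $H$ on $[n]=\{1,\dots,n\}$ such that $\mathbb P(i\sim_G j)=p_{ij}$ for $1\le i<j\le m$; $\mathbb P(i\sim_H j)=p_{ij}$ for $1\le i<j\le n$; for $1\le i<j\le K$ the indicators of $i\sim_G j$ and $i\sim_H j$ have Pearson correlation coefficient $\varrho_{ij}$; and, apart from these correlations, all adjacencies are collectively independent (that is, the pairs $(\mathbf 1_{i\sim_G j},\mathbf 1_{i\sim_H j})$, $1\le i<j\le K$, together with the remaining single indicators $\mathbf 1_{i\sim_G j}$ ($i<j\le m$, $j>K$) and $\mathbf 1_{i\sim_H j}$ ($i<j\le n$, $j>K$), form a mutually independent family). Let $A\in\{0,\pm1\}^{m\times m}$ be the $\pm1$-adjacency matrix of $G$: $A_{ii}=0$ and, for $i\ne j$, $A_{ij}=1$ if $i\sim_G j$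 and $A_{ij}=-1$ otherwise; let $B\in\{0,\pm1\}^{n\times n}$ be the corresponding matrix of $H$. Let $\Pi_{m,n,K}$ be the set of $m\times n$ matrices with entries in $\{0,1\}$, all row sums and all column sums at most $1$, and entries summing to $K$. **Assumptions.** For every $\mathfrak n=1,2,3,\dots$ a model instance with $\max\{m,n\}=\mathfrak n$ is given (so $m,n,K,p_{ij},\varrho_{ij}$ all depend on $\mathfrak n$), with correlated Bernoulli random graphs $(G,H)$ having these parameters; the pairs $(G,H)$ for all $\mathfrak n$ are defined on one common probability space, with no assumption on their dependence for different $\mathfrak n$. There is a real number $q\in(0,\tfrac12)$, not depending on $\mathfrak n$, such that for every $\mathfrak n$ one has $p_{ij}\in[q,1-q]$ for all $1\le i<j\le\mathfrak n$ and $\varrho_{ij}>(1-2q)^2$ for all $1\le i<j\le K$. Finally, with $\epsilon=\epsilon(\mathfrak n):=\min_{1\le i<j\le K}\bigl(\varrho_{ij}-(1-2q)^2\bigr)$ (and $\epsilon:=0$ if $K=1$), $$\lim_{\mathfrak n\to\infty}\frac{\epsilon^2K}{\log\mathfrak n}=\infty .$$ **Lemma.** Under these assumptions, with probability $1$, for all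 but finitely many $\mathfrak n$ the bilinear form $\operatorname{trace}(APBQ^{T})$ over pairs $(P,Q)\in\Pi_{m,n,K}\times\Pi_{m,n,K}$ has exactly one maximizer, namely $P=Q=\begin{bmatrix}I_K&0\\0&0\end{bmatrix}$ (of size $m\times n$): $$\operatorname*{arg\,max}_{P,Q\in\Pi_{m,n,K}}\operatorname{trace}(APBQ^{T})=\left\{\left(\begin{bmatrix}I_K&0\\0&0\end{bmatrix},\begin{bmatrix}I_K&0\\0&0\end{bmatrix}\right)\right\}.$$ -/

import Mathlib

open MeasureTheory ProbabilityTheory Filter Topology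

noncomputable section

/-- `matchingMatrices c d e` is the set `Π_{c,d,e}` of `c × d` matrices with entries in `{0,1}`, all
row sums and all column sums at most `1`, and entries summing to `e`. -/
def matchingMatrices (c d e : ℕ) : Set (Matrix (Fin c) (Fin d) ℝ) :=
  {X | (∀ i j, X i j = 0 ∨ X i j = 1) ∧ (∀ i, ∑ j, X i j ≤ 1) ∧ (∀ j, ∑ i, X i j ≤ 1) ∧
    ∑ i, ∑ j, X i j = (e : ℝ)}

/-- The `c × d` block matrix `[[I_K, 0], [0, 0]]`. -/
def coreMatrix (c d K : ℕ) : Matrix (Fin c) (Fin d) ℝ :=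
  Matrix.of fun i j => if (i : ℕ) = (j : ℕ) ∧ (i : ℕ) < K then 1 else 0

open Classical in
/-- The `±1`-adjacency matrix of a graph, with the convention that the diagonal is zero. -/
def signedAdjMatrix {V : Type*} (G : SimpleGraph V) : Matrix V V ℝ :=
  Matrix.of fun i j => if i = j then 0 else if G.Adj i j then 1 else -1

/-- The set of all maximizers of `f` over `s`. -/
def argMaxOn {α : Type*} (f : α → ℝ) (s : Set α) : Set α :=
  {x | x ∈ s ∧ ∀ y ∈ s, f y ≤ f x}

/-- The Pearson correlation coefficient of two real random variables. -/
def pearsonCorr {Ω : Type*} [MeasurableSpace Ω] (X Y : Ω → ℝ) (μ : Measure Ω) : ℝ :=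
  covariance X Y μ / (√(variance X μ) * √(variance Y μ))

/-- The parameters of the correlated Bernoulli random graph model. Vertices are numbered from `0`;
only the values `p i j` with `i < j < max m n` and `rho i j` with `i < j < K` are relevant. -/
structure ModelParams where
  /-- number of vertices of the first graph -/
  m : ℕ
  /-- number of vertices of the second graph -/
  n : ℕ
  /-- size of the core -/
  K : ℕ
  /-- edge probabilities -/
  p : ℕ → ℕ → ℝ
  /-- edge correlations in the core -/
  rho : ℕ → ℕ → ℝ
  K_pos : 0 < K
  K_le_m : K ≤ m
  K_le_n : K ≤ n
  p_mem : ∀ i j, i < j → j < max m n → p i j ∈ Set.Icc (0 : ℝ) 1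
  rho_mem : ∀ i j, i < j → j < K → rho i j ∈ Set.Icc (0 : ℝ) 1

/-- The number `ε = min_{i < j < K} (ρ_{ij} - (1 - 2 q)²)`. It is a minimum over a finite set, which is
nonempty when `K ≥ 2`; for `K = 1` the value is `0`. -/
def ModelParams.eps (M : ModelParams) (q : ℝ) : ℝ :=
  sInf {x : ℝ | ∃ i j : ℕ, i < j ∧ j < M.K ∧ x = M.rho i j - (1 - 2 * q) ^ 2}

/-- The indicator random variable of adjacency of `i` and `j` in the random graph `G`. -/
def adjInd {Ω V : Type*} (G : Ω → SimpleGraph V) (i j : V) : Ω → ℝ :=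
  Set.indicator {ω | (G ω).Adj i j} fun _ => 1

/-- Index set of the collectively independent groups of adjacencies: the core pairs
`i < j < K`, the remaining pairs of the first graph, the remaining pairs of the second graph. -/
abbrev AdjBlock (m n K : ℕ) : Type :=
  {e : Fin K × Fin K // e.1 < e.2} ⊕
    ({e : Fin m × Fin m // e.1 < e.2 ∧ K ≤ (e.2 : ℕ)} ⊕
      {e : Fin n × Fin n // e.1 < e.2 ∧ K ≤ (e.2 : ℕ)})

/-- The random variable of a group: for a core pair, the two adjacency indicators (in `G` and in `H`)
jointly; for any other pair of `G` or of `H`, the single adjacency indicator (the other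
coordinate is the constant `0`). -/
def adjBlockVar {Ω : Type*} {m n K : ℕ} (hm : K ≤ m) (hn : K ≤ n)
    (G : Ω → SimpleGraph (Fin m)) (H : Ω → SimpleGraph (Fin n)) :
    AdjBlock m n K → Ω → ℝ × ℝ
  | .inl e => fun ω =>
      (adjInd G (Fin.castLE hm e.1.1) (Fin.castLE hm e.1.2) ω,
        adjInd H (Fin.castLE hn e.1.1) (Fin.castLE hn e.1.2) ω)
  | .inr (.inl e) => fun ω => (adjInd G e.1.1 e.1.2 ω, 0)
  | .inr (.inr e) => fun ω => (0, adjInd H e.1.1 e.1.2 ω)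

/-- `(G, H)` are correlated Bernoulli random graphs with the given parameters. -/
structure IsCorrelatedBernoulli {Ω : Type*} [MeasurableSpace Ω] (μ : Measure Ω) (M : ModelParams)
    (G : Ω → SimpleGraph (Fin M.m)) (H : Ω → SimpleGraph (Fin M.n)) : Prop where
  measurable_G : Measurable G
  measurable_H : Measurable H
  prob_G : ∀ i j : Fin M.m, i < j → μ.real {ω | (G ω).Adj i j} = M.p i j
  prob_H : ∀ i j : Fin M.n, i < j → μ.real {ω | (H ω).Adj i j} = M.p i j
  corr : ∀ i j : Fin M.K, i < j →
    pearsonCorr (adjInd G (Fin.castLE M.K_le_m i) (Fin.castLE M.K_le_m j))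
      (adjInd H (Fin.castLE M.K_le_n i) (Fin.castLE M.K_le_n j)) μ = M.rho i j
  indep : iIndepFun (adjBlockVar M.K_le_m M.K_le_n G H) μ

end

/-! Write `J` for the core matrix, `s = (1-2q)²`, and `A`, `B` for the signed adjacency matrices.
The gap between the objective at `(J, J)` and at `(P, Q)` is a bilinear form in the signs `A i j`,
`B k l` with coefficients `J j k * J i l - P j k * Q i l`. Its mean is bounded below, its
fluctuations are controlled by bounded differences, and a union bound with Borel–Cantelli finishes.

Mean. The assumptions make `s` a threshold: on an edge aligned by `J` the expected product of signs
is `ρ + (1-ρ)(1-2p)² ≥ s + ε`, whereas signs from different independent groups have expected product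
at most `s`. Both products of matchings have total weight `K²`, so subtracting `s` everywhere costs
nothing. With `x`, `y` the overlaps of `P`, `Q` with `J`, and `d = (K-x) + (K-y)`, the mean gap is
at least `ε(K² - xy) - 3d`. The error comes from zero diagonals and from pairs matched with their
endpoints exchanged (`IsPartialMatching.gap_le_sum`). Since `Kd ≤ 2(K² - xy)`, it is absorbed once
`εK ≥ 12`.

Fluctuations. The absolute coefficients sum to `2(K² - xy)`, with row and column sums at most 2, so
the sum of squared influences is also of order `K² - xy`. McDiarmid's inequality then bounds the
failure probability of `(P, Q)` by `exp(-ε²Kd/2048)`.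

Union bound. A pair `(P, Q)` is encoded by the set `T` of entries where it differs from `(J, J)`,
and `|T| = 2d`. Summing `y^|T|`, now with `y = exp(-ε²K/4096)`, over all nonempty `T` gives
`(1+y)^(2mn) - 1`. This is `O(N⁻²)` as soon as `y ≤ N⁻⁴`, hence summable without any assumption on
the dependence between different `N`. -/

/-! ### Exponential moments under bounded differences on finite product spaces -/

/-- Hoeffding's lemma on a finite set, with a non-optimal constant. -/
theorem sum_mul_exp_le_exp {S : Type*} [Fintype S] (w : S → ℝ) (hw : ∀ s, 0 ≤ w s)
    (hw1 : ∑ s, w s = 1) (g : S → ℝ) (c : ℝ) (hg : ∀ s s', |g s - g s'| ≤ c) :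
    ∑ s, w s * Real.exp (g s) ≤ Real.exp (∑ s, w s * g s + c ^ 2 / 2) := by
  set a := ∑ s, w s * g s with ha
  have hdev : ∀ s, |g s - a| ≤ c := by
    intro s
    have h1 : g s - a = ∑ s', w s' * (g s - g s') := by
      simp only [mul_sub, Finset.sum_sub_distrib, ← Finset.sum_mul, hw1, one_mul, ha]
    rw [h1]
    calc |∑ s', w s' * (g s - g s')| ≤ ∑ s', |w s' * (g s - g s')| :=
          Finset.abs_sum_le_sum_abs _ _
      _ ≤ ∑ s', w s' * c := by
          refine Finset.sum_le_sum fun s' _ => ?_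
          rw [abs_mul, abs_of_nonneg (hw s')]
          exact mul_le_mul_of_nonneg_left (hg s s') (hw s')
      _ = c := by rw [← Finset.sum_mul, hw1, one_mul]
  -- Convexity puts `exp` below its chord on `[-c, c]`; the linear part of the chord averages to
  -- zero because `a` is the mean.
  have hkey : ∀ s, Real.exp (g s - a) ≤ Real.cosh c + (g s - a) / c * Real.sinh c := by
    intro s
    rcases eq_or_ne c 0 with hc | hc
    · have := hdev s
      rw [hc] at this
      have h0 : g s - a = 0 := abs_nonpos_iff.mp this
      simp [h0, hc]
    · have hc0 : 0 < c := lt_of_le_of_ne ((abs_nonneg _).trans (hdev s)) hc.symm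
      have h1 : |(g s - a) / c| ≤ 1 := by
        rw [abs_div, abs_of_pos hc0]
        exact (div_le_one hc0).mpr (hdev s)
      have := Real.exp_mul_le_cosh_add_mul_sinh h1 c
      rwa [div_mul_cancel₀ _ hc] at this
  have hsum : ∑ s, w s * Real.exp (g s - a) ≤ Real.cosh c := by
    calc ∑ s, w s * Real.exp (g s - a)
        ≤ ∑ s, w s * (Real.cosh c + (g s - a) / c * Real.sinh c) :=
          Finset.sum_le_sum fun s _ => mul_le_mul_of_nonneg_left (hkey s) (hw s)
      _ = (∑ s, w s) * Real.cosh c +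
            (∑ s, w s * g s - (∑ s, w s) * a) / c * Real.sinh c := by
          simp only [Finset.sum_mul, ← Finset.sum_sub_distrib, Finset.sum_div,
            ← Finset.sum_add_distrib]
          exact Finset.sum_congr rfl fun s _ => by ring
      _ = Real.cosh c := by rw [hw1, ← ha]; ring
  calc ∑ s, w s * Real.exp (g s) = Real.exp a * ∑ s, w s * Real.exp (g s - a) := by
        rw [Finset.mul_sum]
        refine Finset.sum_congr rfl fun s _ => ?_
        rw [mul_left_comm, ← Real.exp_add]
        congr 2
        ring
    _ ≤ Real.exp a * Real.exp (c ^ 2 / 2) :=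
        mul_le_mul_of_nonneg_left (hsum.trans (Real.cosh_le_exp_half_sq c)) (Real.exp_pos _).le
    _ = _ := by rw [← Real.exp_add]

theorem sum_prod_weight_eq_one {ι S : Type*} [Fintype ι] [DecidableEq ι] [Fintype S]
    (w : ι → S → ℝ) (hw1 : ∀ i, ∑ s, w i s = 1) : ∑ x : ι → S, ∏ i, w i (x i) = 1 := by
  rw [← Fintype.prod_sum]
  simp [hw1]

theorem sum_fin_succ_pi {S : Type*} [Fintype S] {n : ℕ} (F : (Fin (n + 1) → S) → ℝ) :
    ∑ x, F x = ∑ s, ∑ y : Fin n → S, F (Fin.cons s y) := by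
  rw [← Fintype.sum_prod_type' (f := fun s (y : Fin n → S) => F (Fin.cons s y))]
  exact (Fintype.sum_equiv (Fin.consEquiv fun _ => S) _ _ fun _ => rfl).symm

/-- Exponential moment bound for functions with bounded differences of independent coordinates. -/
theorem sum_prod_mul_exp_le_fin {S : Type*} [Fintype S] (n : ℕ) (w : Fin n → S → ℝ)
    (hw : ∀ i s, 0 ≤ w i s) (hw1 : ∀ i, ∑ s, w i s = 1) (c : Fin n → ℝ)
    (f : (Fin n → S) → ℝ) (hf : ∀ i x s, |f (Function.update x i s) - f x| ≤ c i) :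
    ∑ x, (∏ i, w i (x i)) * Real.exp (f x) ≤
      Real.exp (∑ x, (∏ i, w i (x i)) * f x + (∑ i, c i ^ 2) / 2) := by
  induction n with
  | zero => simp
  | succ n ih =>
    set g : S → ℝ := fun s => ∑ y : Fin n → S, (∏ i, w i.succ (y i)) * f (Fin.cons s y) with hgdef
    have hcond : ∀ s, ∑ y : Fin n → S, (∏ i, w i.succ (y i)) * Real.exp (f (Fin.cons s y)) ≤
        Real.exp (g s + (∑ i : Fin n, c i.succ ^ 2) / 2) := by
      intro s
      refine ih (fun i => w i.succ) (fun i => hw _) (fun i => hw1 _) (fun i => c i.succ)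
        (fun y => f (Fin.cons s y)) fun i y s' => ?_
      have := hf i.succ (Fin.cons s y) s'
      rwa [← Fin.cons_update] at this
    -- Averaging over the remaining coordinates does not increase the oscillation in the first one,
    -- so Hoeffding's lemma applies to the conditional mean `g`.
    have hg : ∀ s s', |g s - g s'| ≤ c 0 := by
      intro s s'
      rw [hgdef]
      simp only [← Finset.sum_sub_distrib, ← mul_sub]
      have hP : ∀ y : Fin n → S, 0 ≤ ∏ i, w i.succ (y i) :=
        fun y => Finset.prod_nonneg fun i _ => hw _ _
      calc |∑ y : Fin n → S, (∏ i, w i.succ (y i)) * (f (Fin.cons s y) - f (Fin.cons s' y))|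
          ≤ ∑ y : Fin n → S, |(∏ i, w i.succ (y i)) * (f (Fin.cons s y) - f (Fin.cons s' y))| :=
            Finset.abs_sum_le_sum_abs _ _
        _ ≤ ∑ y : Fin n → S, (∏ i, w i.succ (y i)) * c 0 := by
            refine Finset.sum_le_sum fun y _ => ?_
            rw [abs_mul, abs_of_nonneg (hP y)]
            refine mul_le_mul_of_nonneg_left ?_ (hP y)
            have := hf 0 (Fin.cons s' y) s
            rwa [Fin.update_cons_zero] at this
        _ = c 0 := by
            rw [← Finset.sum_mul, sum_prod_weight_eq_one _ fun i => hw1 _, one_mul]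
    have hsplit : ∀ F : (Fin (n + 1) → S) → ℝ, ∑ x, (∏ i, w i (x i)) * F x =
        ∑ s, w 0 s * ∑ y : Fin n → S, (∏ i, w i.succ (y i)) * F (Fin.cons s y) := by
      intro F
      rw [sum_fin_succ_pi]
      refine Finset.sum_congr rfl fun s _ => ?_
      rw [Finset.mul_sum]
      refine Finset.sum_congr rfl fun y _ => ?_
      rw [Fin.prod_univ_succ]
      simp [mul_assoc]
    rw [hsplit, hsplit, Fin.sum_univ_succ]
    calc ∑ s, w 0 s * ∑ y : Fin n → S, (∏ i, w i.succ (y i)) * Real.exp (f (Fin.cons s y))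
        ≤ ∑ s, w 0 s * Real.exp (g s + (∑ i : Fin n, c i.succ ^ 2) / 2) :=
          Finset.sum_le_sum fun s _ => mul_le_mul_of_nonneg_left (hcond s) (hw 0 s)
      _ = (∑ s, w 0 s * Real.exp (g s)) * Real.exp ((∑ i : Fin n, c i.succ ^ 2) / 2) := by
          rw [Finset.sum_mul]
          exact Finset.sum_congr rfl fun s _ => by rw [Real.exp_add, mul_assoc]
      _ ≤ Real.exp (∑ s, w 0 s * g s + c 0 ^ 2 / 2) *
            Real.exp ((∑ i : Fin n, c i.succ ^ 2) / 2) :=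
          mul_le_mul_of_nonneg_right (sum_mul_exp_le_exp (w 0) (hw 0) (hw1 0) g (c 0) hg)
            (Real.exp_pos _).le
      _ = _ := by
          rw [← Real.exp_add]
          congr 1
          ring

theorem sum_prod_mul_exp_le {ι S : Type*} [Fintype ι] [DecidableEq ι] [Fintype S]
    (w : ι → S → ℝ) (hw : ∀ i s, 0 ≤ w i s) (hw1 : ∀ i, ∑ s, w i s = 1) (c : ι → ℝ)
    (f : (ι → S) → ℝ) (hf : ∀ i x s, |f (Function.update x i s) - f x| ≤ c i) :
    ∑ x, (∏ i, w i (x i)) * Real.exp (f x) ≤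
      Real.exp (∑ x, (∏ i, w i (x i)) * f x + (∑ i, c i ^ 2) / 2) := by
  let e := Fintype.equivFin ι
  have key := sum_prod_mul_exp_le_fin (Fintype.card ι) (fun k => w (e.symm k)) (fun _ => hw _)
    (fun _ => hw1 _) (fun k => c (e.symm k)) (fun x => f (x ∘ e)) (by
      intro k x s
      have := hf (e.symm k) (x ∘ e) s
      rwa [← Function.update_comp_equiv] at this)
  have hsum : ∀ F : (ι → S) → ℝ, ∑ x : Fin (Fintype.card ι) → S,
      (∏ k, w (e.symm k) (x k)) * F (x ∘ e) = ∑ x, (∏ i, w i (x i)) * F x := by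
    intro F
    refine Fintype.sum_equiv (Equiv.arrowCongr e.symm (Equiv.refl S)) _ _ fun x => ?_
    have : (Equiv.arrowCongr e.symm (Equiv.refl S)) x = x ∘ e := by
      funext i; simp [Equiv.arrowCongr]
    rw [this]
    congr 1
    exact Fintype.prod_equiv e.symm _ _ fun k => by simp
  rw [hsum (fun x => Real.exp (f x)), hsum f] at key
  rwa [Fintype.sum_equiv e.symm (fun k => c (e.symm k) ^ 2) (fun i => c i ^ 2) fun _ => rfl]
    at key

/-! ### McDiarmid's inequality for independent finite-valued variables -/

section Independent

variable {Ω ι S : Type*} [MeasurableSpace Ω] {μ : Measure Ω} [IsProbabilityMeasure μ] [Fintype ι]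
  [DecidableEq ι] [Fintype S] [MeasurableSpace S] [MeasurableSingletonClass S] {Z : ι → Ω → S}

/-- Independence makes the joint law a product of point weights, which reduces expectations to the
finite weighted sums treated above. -/
theorem ProbabilityTheory.iIndepFun.integral_comp_eq_sum (hZ : iIndepFun Z μ)
    (hm : ∀ i, Measurable (Z i)) (F : (ι → S) → ℝ) :
    ∫ ω, F (fun i => Z i ω) ∂μ = ∑ x, (∏ i, μ.real (Z i ⁻¹' {x i})) * F x := by
  have hmZ : Measurable fun ω i => Z i ω := measurable_pi_lambda _ hm
  have hmF : Measurable F := measurable_of_finite F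
  have hp : IsProbabilityMeasure (μ.map fun ω i => Z i ω) :=
    Measure.isProbabilityMeasure_map hmZ.aemeasurable
  rw [← integral_map (φ := fun ω i => Z i ω) hmZ.aemeasurable hmF.aestronglyMeasurable,
    integral_fintype Integrable.of_finite]
  refine Finset.sum_congr rfl fun x _ => ?_
  rw [smul_eq_mul, map_measureReal_apply hmZ (measurableSet_singleton x)]
  congr 1
  have h1 : (fun ω i => Z i ω) ⁻¹' {x} = ⋂ i ∈ (Finset.univ : Finset ι), Z i ⁻¹' {x i} := by
    ext ω
    simp [funext_iff]
  rw [h1, measureReal_def, hZ.measure_inter_preimage_eq_mul Finset.univ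
    (fun i _ => measurableSet_singleton (x i)), ENNReal.toReal_prod]
  rfl

/-- McDiarmid's inequality for independent random variables with finitely many values, with a
non-optimal constant. -/
theorem ProbabilityTheory.iIndepFun.measureReal_nonpos_le_exp
    (hZ : iIndepFun Z μ) (hm : ∀ i, Measurable (Z i)) (F : (ι → S) → ℝ) (c : ι → ℝ)
    (hF : ∀ i x s, |F (Function.update x i s) - F x| ≤ c i) (V E : ℝ) (hV : ∑ i, c i ^ 2 ≤ V)
    (hV0 : 0 < V) (hE0 : 0 ≤ E) (hE : E ≤ ∫ ω, F (fun i => Z i ω) ∂μ) :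
    μ.real {ω | F (fun i => Z i ω) ≤ 0} ≤ Real.exp (-(E ^ 2 / (2 * V))) := by
  have hint : ∀ F : (ι → S) → ℝ, Integrable (fun ω => F (fun i => Z i ω)) μ := by
    intro F
    have hmF : Measurable F := measurable_of_finite F
    have hmZ : Measurable fun ω i => Z i ω := measurable_pi_lambda _ hm
    obtain ⟨C, hC⟩ := (Set.finite_range fun x => ‖F x‖).bddAbove
    exact Integrable.of_bound (hmF.comp hmZ).aestronglyMeasurable C
      (Eventually.of_forall fun ω => hC ⟨_, rfl⟩)
  -- The Chernoff parameter minimizing `-l * E + l ^ 2 * V / 2`.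
  set l : ℝ := E / V with hl
  have hl0 : 0 ≤ l := div_nonneg hE0 hV0.le
  have h1 : μ.real {ω | F (fun i => Z i ω) ≤ 0} ≤
      ∫ ω, Real.exp (-l * F (fun i => Z i ω)) ∂μ := by
    have := mul_meas_ge_le_integral_of_nonneg (μ := μ)
      (f := fun ω => Real.exp (-l * F (fun i => Z i ω)))
      (Eventually.of_forall fun ω => (Real.exp_pos _).le)
      (hint fun x => Real.exp (-l * F x)) 1
    rw [one_mul] at this
    refine le_trans (measureReal_mono fun ω hω => ?_) this
    simp only [Set.mem_ofPred_eq] at hω ⊢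
    rw [Real.one_le_exp_iff]
    nlinarith
  refine h1.trans ?_
  rw [iIndepFun.integral_comp_eq_sum hZ hm fun x => Real.exp (-l * F x)]
  refine (sum_prod_mul_exp_le (fun i s => μ.real (Z i ⁻¹' {s})) (fun _ _ => measureReal_nonneg)
    ?_ (fun i => l * c i) (fun x => -l * F x) ?_).trans ?_
  · intro i
    have h2 := sum_measureReal_preimage_singleton (μ := μ) (f := Z i) Finset.univ
      (fun s _ => hm i (measurableSet_singleton s))
    simpa using h2
  · intro i x s
    rw [← mul_sub, abs_mul, abs_neg, abs_of_nonneg hl0]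
    exact mul_le_mul_of_nonneg_left (hF i x s) hl0
  · rw [Real.exp_le_exp]
    have h3 : ∑ x, (∏ i, μ.real (Z i ⁻¹' {x i})) * (-l * F x) =
        -l * ∫ ω, F (fun i => Z i ω) ∂μ := by
      rw [iIndepFun.integral_comp_eq_sum hZ hm F, Finset.mul_sum]
      exact Finset.sum_congr rfl fun x _ => by ring
    have h4 : ∑ i, (l * c i) ^ 2 = l ^ 2 * ∑ i, c i ^ 2 := by
      rw [Finset.mul_sum]
      exact Finset.sum_congr rfl fun i _ => by ring
    rw [h3, h4]
    have h5 : l ^ 2 * ∑ i, c i ^ 2 ≤ l ^ 2 * V := mul_le_mul_of_nonneg_left hV (sq_nonneg l)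
    have h6 : l * E ≤ l * ∫ ω, F (fun i => Z i ω) ∂μ := mul_le_mul_of_nonneg_left hE hl0
    have h7 : l ^ 2 * V = l * E := by rw [hl]; field_simp
    have h8 : E ^ 2 / (2 * V) = l * E / 2 := by rw [hl]; field_simp
    rw [h8]
    linarith

end Independent

/-! ### Concentration of bilinear forms in independent signs -/

theorem abs_mul_sub_mul_le {a a' b b' s t : ℝ} (ha : |a| ≤ 1) (hb : |b'| ≤ 1)
    (hs : |a' - a| ≤ s) (ht : |b' - b| ≤ t) : |a' * b' - a * b| ≤ s + t := by
  have h : a' * b' - a * b = (a' - a) * b' + a * (b' - b) := by ring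
  rw [h]
  refine (abs_add_le _ _).trans ?_
  rw [abs_mul, abs_mul]
  have h1 := mul_le_mul hs hb (abs_nonneg _) ((abs_nonneg _).trans hs)
  have h2 := mul_le_mul ha ht (abs_nonneg _) zero_le_one
  linarith

/-- The value at `x` of a function of the coordinate `o`, or `0` if there is no coordinate. -/
def coordVal {ι S : Type*} (u : S → ℝ) (x : ι → S) (o : Option ι) : ℝ :=
  o.elim 0 fun i => u (x i)

theorem abs_coordVal_le {ι S : Type*} {u : S → ℝ} (hu : ∀ s, |u s| ≤ 1) (x : ι → S)
    (o : Option ι) : |coordVal u x o| ≤ 1 := by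
  cases o with
  | none => simp [coordVal]
  | some i => exact hu _

theorem abs_coordVal_update_sub_le {ι S : Type*} [DecidableEq ι] {u : S → ℝ}
    (hu : ∀ s, |u s| ≤ 1) (x : ι → S) (o : Option ι) (i : ι) (s : S) :
    |coordVal u (Function.update x i s) o - coordVal u x o| ≤ if o = some i then 2 else 0 := by
  cases o with
  | none => simp [coordVal]
  | some k =>
    by_cases hk : k = i
    · subst hk
      simp only [if_true]
      refine (abs_sub _ _).trans ?_
      have h1 := abs_coordVal_le hu (Function.update x k s) (some k)
      have h2 := abs_coordVal_le hu x (some k)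
      linarith
    · simp [coordVal, hk]

/-- One half of the influence of coordinate `i`: at most two signs depend on it, each moves by at
most 2, and each carries total coefficient at most 2. -/
theorem sum_sum_ite_mul_le {ι A B : Type*} [DecidableEq ι] [Fintype A] [Fintype B]
    (c : A → B → ℝ) (g : A → Option ι) (i : ι)
    (hrow : ∀ p, ∑ r, |c p r| ≤ 2) (hg : (Finset.univ.filter fun p => g p = some i).card ≤ 2) :
    ∑ p, ∑ r, |c p r| * (if g p = some i then 2 else 0) ≤ 8 := by
  calc ∑ p, ∑ r, |c p r| * (if g p = some i then 2 else 0)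
      ≤ ∑ p, (if g p = some i then (4 : ℝ) else 0) := by
        refine Finset.sum_le_sum fun p _ => ?_
        rw [← Finset.sum_mul]
        have := hrow p
        split_ifs <;> linarith
    _ = (Finset.univ.filter fun p => g p = some i).card * 4 := by
        rw [← Finset.sum_filter, Finset.sum_const, nsmul_eq_mul]
    _ ≤ 8 := by
        have : ((Finset.univ.filter fun p => g p = some i).card : ℝ) ≤ 2 := by exact_mod_cast hg
        linarith

section Bilinear

variable {Ω ι S A B : Type*} [MeasurableSpace Ω] {μ : Measure Ω} [IsProbabilityMeasure μ]
  [Fintype ι] [DecidableEq ι] [Fintype S] [MeasurableSpace S] [MeasurableSingletonClass S]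
  [Fintype A] [Fintype B] {Z : ι → Ω → S}

theorem sum_ite_some_le (o : Option ι) : ∑ i, (if o = some i then (2 : ℝ) else 0) ≤ 2 := by
  cases o with
  | none => simp
  | some k => simp

/-- Tail bound for a bilinear form in two arrays of signs that are functions of single
coordinates of an independent family. -/
theorem ProbabilityTheory.iIndepFun.measureReal_bilinear_nonpos_le (hZ : iIndepFun Z μ)
    (hm : ∀ i, Measurable (Z i)) (c : A → B → ℝ) (g : A → Option ι) (h : B → Option ι)
    (u v : S → ℝ) (hu : ∀ s, |u s| ≤ 1) (hv : ∀ s, |v s| ≤ 1)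
    (hrow : ∀ p, ∑ r, |c p r| ≤ 2) (hcol : ∀ r, ∑ p, |c p r| ≤ 2)
    (hg : ∀ i, (Finset.univ.filter fun p => g p = some i).card ≤ 2)
    (hh : ∀ i, (Finset.univ.filter fun r => h r = some i).card ≤ 2)
    (W E : ℝ) (hW : ∑ p, ∑ r, |c p r| ≤ W) (hW0 : 0 < W) (hE0 : 0 ≤ E)
    (hE : E ≤ ∫ ω, ∑ p, ∑ r, c p r * (coordVal u (fun i => Z i ω) (g p) *
      coordVal v (fun i => Z i ω) (h r)) ∂μ) :
    μ.real {ω | ∑ p, ∑ r, c p r * (coordVal u (fun i => Z i ω) (g p) *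
      coordVal v (fun i => Z i ω) (h r)) ≤ 0} ≤ Real.exp (-(E ^ 2 / (128 * W))) := by
  set C : ι → ℝ := fun i => ∑ p, ∑ r, |c p r| *
    ((if g p = some i then 2 else 0) + if h r = some i then 2 else 0) with hC
  have hC0 : ∀ i, 0 ≤ C i := fun i => Finset.sum_nonneg fun p _ => Finset.sum_nonneg fun r _ =>
    mul_nonneg (abs_nonneg _) (by split_ifs <;> norm_num)
  have hC16 : ∀ i, C i ≤ 16 := by
    intro i
    have h1 := sum_sum_ite_mul_le c g i hrow (hg i)
    have h2 := sum_sum_ite_mul_le (fun r p => c p r) h i hcol (hh i)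
    rw [Finset.sum_comm] at h2
    simp only [hC, mul_add, Finset.sum_add_distrib]
    linarith
  have hCsum : ∑ i, C i ≤ 4 * W := by
    calc ∑ i, C i = ∑ p, ∑ r, |c p r| * (∑ i, (if g p = some i then (2 : ℝ) else 0) +
          ∑ i, if h r = some i then (2 : ℝ) else 0) := by
          simp only [hC]
          rw [Finset.sum_comm]
          refine Finset.sum_congr rfl fun p _ => ?_
          rw [Finset.sum_comm]
          refine Finset.sum_congr rfl fun r _ => ?_
          rw [← Finset.mul_sum, Finset.sum_add_distrib]
      _ ≤ ∑ p, ∑ r, |c p r| * 4 := by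
          refine Finset.sum_le_sum fun p _ => Finset.sum_le_sum fun r _ =>
            mul_le_mul_of_nonneg_left ?_ (abs_nonneg _)
          have := sum_ite_some_le (g p)
          have := sum_ite_some_le (h r)
          linarith
      _ ≤ 4 * W := by
          simp only [← Finset.sum_mul]
          linarith
  -- The maximal influence 16 times the total influence `4 * W`; this keeps the variance proxy
  -- linear in `W`.
  have hV : ∑ i, C i ^ 2 ≤ 64 * W := by
    calc ∑ i, C i ^ 2 ≤ ∑ i, 16 * C i :=
          Finset.sum_le_sum fun i _ => by nlinarith [hC0 i, hC16 i]
      _ ≤ 64 * W := by rw [← Finset.mul_sum]; linarith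
  have key := iIndepFun.measureReal_nonpos_le_exp hZ hm
    (fun x => ∑ p, ∑ r, c p r * (coordVal u x (g p) * coordVal v x (h r))) C ?_ (64 * W) E hV
    (by linarith) hE0 hE
  · refine key.trans (le_of_eq ?_)
    congr 3
    ring
  · intro i x s
    simp only [← Finset.sum_sub_distrib, ← mul_sub]
    refine (Finset.abs_sum_le_sum_abs _ _).trans (Finset.sum_le_sum fun p _ => ?_)
    refine (Finset.abs_sum_le_sum_abs _ _).trans (Finset.sum_le_sum fun r _ => ?_)
    rw [abs_mul]
    exact mul_le_mul_of_nonneg_left (abs_mul_sub_mul_le (abs_coordVal_le hu _ _)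
      (abs_coordVal_le hv _ _) (abs_coordVal_update_sub_le hu _ _ _ _)
      (abs_coordVal_update_sub_le hv _ _ _ _)) (abs_nonneg _)

end Bilinear

/-! ### Partial matchings and the deterministic gap estimate -/

section Matching

variable {α β : Type*} [Fintype α] [Fintype β]

theorem sum_sum_mul_mul (u v : α → β → ℝ) :
    ∑ p : α × α, ∑ r : β × β, u p.2 r.1 * v p.1 r.2 = (∑ i, ∑ k, u i k) * ∑ i, ∑ k, v i k := by
  simp only [Fintype.sum_prod_type]
  calc ∑ i, ∑ j, ∑ k, ∑ l, u j k * v i l = ∑ i, ∑ j, (∑ k, u j k) * ∑ l, v i l := by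
        simp only [Finset.sum_mul_sum]
    _ = (∑ i, ∑ k, u i k) * ∑ i, ∑ k, v i k := by
        rw [Finset.sum_comm, Finset.sum_mul_sum]

/-- A `0/1`-matrix with row and column sums at most `1`. -/
structure IsPartialMatching (X : α → β → ℝ) : Prop where
  zero_or_one : ∀ i j, X i j = 0 ∨ X i j = 1
  row_le : ∀ i, ∑ j, X i j ≤ 1
  col_le : ∀ j, ∑ i, X i j ≤ 1

namespace IsPartialMatching

variable {J P Q X : α → β → ℝ}

theorem nonneg (hX : IsPartialMatching X) (i : α) (j : β) : 0 ≤ X i j := by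
  rcases hX.zero_or_one i j with h | h <;> simp [h]

theorem le_one (hX : IsPartialMatching X) (i : α) (j : β) : X i j ≤ 1 := by
  rcases hX.zero_or_one i j with h | h <;> simp [h]

theorem eq_zero_of_ne (hX : IsPartialMatching X) {i j : α} {l : β} (hij : i ≠ j)
    (h : X j l = 1) : X i l = 0 := by
  classical
  rcases hX.zero_or_one i l with h0 | h1
  · exact h0
  · have h2 : ∑ k ∈ {i, j}, X k l ≤ ∑ k, X k l :=
      Finset.sum_le_sum_of_subset_of_nonneg (Finset.subset_univ _) fun k _ _ => hX.nonneg k l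
    rw [Finset.sum_pair hij, h, h1] at h2
    linarith [hX.col_le l]

theorem sum_abs_row_le (hJ : IsPartialMatching J) (hP : IsPartialMatching P)
    (hQ : IsPartialMatching Q) (p : α × α) :
    ∑ r : β × β, |J p.2 r.1 * J p.1 r.2 - P p.2 r.1 * Q p.1 r.2| ≤ 2 := by
  have h : ∀ {X Y : α → β → ℝ}, IsPartialMatching X → IsPartialMatching Y →
      ∑ r : β × β, |X p.2 r.1 * Y p.1 r.2| ≤ 1 := by
    intro X Y hX hY
    rw [Fintype.sum_prod_type]
    simp only [abs_of_nonneg (mul_nonneg (hX.nonneg _ _) (hY.nonneg _ _))]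
    rw [← Finset.sum_mul_sum]
    exact mul_le_one₀ (hX.row_le _) (Finset.sum_nonneg fun l _ => hY.nonneg _ _) (hY.row_le _)
  calc _ ≤ ∑ r : β × β, (|J p.2 r.1 * J p.1 r.2| + |P p.2 r.1 * Q p.1 r.2|) :=
        Finset.sum_le_sum fun r _ => abs_sub _ _
    _ ≤ 2 := by
        rw [Finset.sum_add_distrib]
        linarith [h hJ hJ, h hP hQ]

theorem sum_abs_col_le (hJ : IsPartialMatching J) (hP : IsPartialMatching P)
    (hQ : IsPartialMatching Q) (r : β × β) :
    ∑ p : α × α, |J p.2 r.1 * J p.1 r.2 - P p.2 r.1 * Q p.1 r.2| ≤ 2 := by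
  have h : ∀ {X Y : α → β → ℝ}, IsPartialMatching X → IsPartialMatching Y →
      ∑ p : α × α, |X p.2 r.1 * Y p.1 r.2| ≤ 1 := by
    intro X Y hX hY
    rw [Fintype.sum_prod_type]
    simp only [abs_of_nonneg (mul_nonneg (hX.nonneg _ _) (hY.nonneg _ _))]
    rw [Finset.sum_comm, ← Finset.sum_mul_sum]
    exact mul_le_one₀ (hX.col_le _) (Finset.sum_nonneg fun l _ => hY.nonneg _ _) (hY.col_le _)
  calc _ ≤ ∑ p : α × α, (|J p.2 r.1 * J p.1 r.2| + |P p.2 r.1 * Q p.1 r.2|) :=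
        Finset.sum_le_sum fun r _ => abs_sub _ _
    _ ≤ 2 := by
        rw [Finset.sum_add_distrib]
        linarith [h hJ hJ, h hP hQ]

/-- For bits, `|ab - cd| = ab + cd - 2(ac)(bd)`, and each of the three sums factors. -/
theorem sum_abs_eq (hJ : IsPartialMatching J) (hP : IsPartialMatching P)
    (hQ : IsPartialMatching Q) {K : ℝ} (hJK : ∑ i, ∑ k, J i k = K) (hPK : ∑ i, ∑ k, P i k = K)
    (hQK : ∑ i, ∑ k, Q i k = K) :
    ∑ p : α × α, ∑ r : β × β, |J p.2 r.1 * J p.1 r.2 - P p.2 r.1 * Q p.1 r.2| =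
      2 * (K ^ 2 - (∑ i, ∑ k, J i k * P i k) * ∑ i, ∑ k, J i k * Q i k) := by
  have h : ∀ (p : α × α) (r : β × β), |J p.2 r.1 * J p.1 r.2 - P p.2 r.1 * Q p.1 r.2| =
      J p.2 r.1 * J p.1 r.2 + P p.2 r.1 * Q p.1 r.2 -
        2 * ((J p.2 r.1 * P p.2 r.1) * (J p.1 r.2 * Q p.1 r.2)) := by
    intro p r
    rcases hJ.zero_or_one p.2 r.1 with h1 | h1 <;> rcases hJ.zero_or_one p.1 r.2 with h2 | h2 <;>
    rcases hP.zero_or_one p.2 r.1 with h3 | h3 <;> rcases hQ.zero_or_one p.1 r.2 with h4 | h4 <;>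
    rw [h1, h2, h3, h4] <;> norm_num
  simp only [h, Finset.sum_sub_distrib, Finset.sum_add_distrib, ← Finset.mul_sum]
  rw [sum_sum_mul_mul J J, sum_sum_mul_mul P Q,
    sum_sum_mul_mul (fun i k => J i k * P i k) fun i k => J i k * Q i k, hJK, hPK, hQK]
  ring

theorem sum_mul_nonneg (hJ : IsPartialMatching J) (hP : IsPartialMatching P) :
    0 ≤ ∑ i, ∑ k, J i k * P i k :=
  Finset.sum_nonneg fun i _ => Finset.sum_nonneg fun k _ =>
    mul_nonneg (hJ.nonneg i k) (hP.nonneg i k)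

theorem sum_mul_le (hJ : IsPartialMatching J) (hP : IsPartialMatching P) {K : ℝ}
    (hJK : ∑ i, ∑ k, J i k = K) : ∑ i, ∑ k, J i k * P i k ≤ K := by
  rw [← hJK]
  exact Finset.sum_le_sum fun i _ => Finset.sum_le_sum fun k _ =>
    mul_le_of_le_one_right (hJ.nonneg i k) (hP.le_one i k)

/-- Controls the loss from `A i i = 0`: the aligned terms with `p.1 = p.2` contribute nothing to the
mean, and they matter only where `P` or `Q` departs from `J`. -/
theorem sum_diag_le [DecidableEq α] (hJ : IsPartialMatching J) (hP : IsPartialMatching P)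
    (hQ : IsPartialMatching Q) :
    ∑ p : α × α, ∑ r : β × β, (if p.1 = p.2 then
      J p.2 r.1 * J p.1 r.2 * ((1 - P p.2 r.1) + (1 - Q p.1 r.2)) else 0) ≤
      ∑ i, ∑ k, J i k * (1 - P i k) + ∑ i, ∑ k, J i k * (1 - Q i k) := by
  rw [Fintype.sum_prod_type, ← Finset.sum_add_distrib]
  refine Finset.sum_le_sum fun i _ => ?_
  rw [Finset.sum_eq_single i (fun j _ hj => by simp [hj.symm]) (by simp)]
  simp only [if_true]
  rw [Fintype.sum_prod_type]
  have h1 : ∑ k, ∑ l, J i k * J i l * ((1 - P i k) + (1 - Q i l)) =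
      (∑ k, J i k * (1 - P i k)) * ∑ l, J i l + (∑ k, J i k) * ∑ l, J i l * (1 - Q i l) := by
    rw [Finset.sum_mul_sum, Finset.sum_mul_sum, ← Finset.sum_add_distrib]
    refine Finset.sum_congr rfl fun k _ => ?_
    rw [← Finset.sum_add_distrib]
    exact Finset.sum_congr rfl fun l _ => by ring
  rw [h1]
  have h2 : ∀ {Y : α → β → ℝ}, IsPartialMatching Y → 0 ≤ ∑ k, J i k * (1 - Y i k) :=
    fun hY => Finset.sum_nonneg fun k _ =>
      mul_nonneg (hJ.nonneg i k) (sub_nonneg.mpr (hY.le_one i k))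
  have h3 := hJ.row_le i
  nlinarith [h2 hP, h2 hQ]

/-- Controls the terms where `i`, `j` are matched to each other's partners: these also see the same
core edge, but `J` leaves at most one such term for each wrong entry of `Q`. -/
theorem sum_swap_le (hJ : IsPartialMatching J) (hQ : IsPartialMatching Q) :
    ∑ p : α × α, ∑ r : β × β, Q p.1 r.2 * (1 - J p.1 r.2) * (J p.1 r.1 * J p.2 r.2) ≤
      ∑ i, ∑ k, Q i k * (1 - J i k) := by
  simp only [Fintype.sum_prod_type]
  refine Finset.sum_le_sum fun i _ => ?_
  have h1 : ∑ j, ∑ k, ∑ l, Q i l * (1 - J i l) * (J i k * J j l) =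
      ∑ l, Q i l * (1 - J i l) * ((∑ k, J i k) * ∑ j, J j l) := by
    rw [Finset.sum_comm, Finset.sum_congr rfl fun k _ => Finset.sum_comm, Finset.sum_comm]
    refine Finset.sum_congr rfl fun l _ => ?_
    rw [Finset.sum_mul_sum, Finset.mul_sum]
    exact Finset.sum_congr rfl fun k _ => (Finset.mul_sum _ _ _).symm
  rw [h1]
  refine Finset.sum_le_sum fun l _ => mul_le_of_le_one_right
    (mul_nonneg (hQ.nonneg i l) (sub_nonneg.mpr (hJ.le_one i l))) ?_
  exact mul_le_one₀ (hJ.row_le i) (Finset.sum_nonneg fun j _ => hJ.nonneg j l) (hJ.col_le l)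

/-- Lower bound for the gap between the value at `(J, J)` and at `(P, Q)` of a bilinear matching
objective whose weights `e` are large on the pairs aligned by `J`. -/
theorem gap_le_sum [DecidableEq α] (hJ : IsPartialMatching J) (hP : IsPartialMatching P)
    (hQ : IsPartialMatching Q) {K : ℝ} (hJK : ∑ i, ∑ k, J i k = K) (hPK : ∑ i, ∑ k, P i k = K)
    (hQK : ∑ i, ∑ k, Q i k = K) (e : α × α → β × β → ℝ) {s ε : ℝ} (hs0 : 0 ≤ s) (hs1 : s ≤ 1)
    (hε : ε ≤ 1) (hdiag : ∀ i r, e (i, i) r = 0)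
    (hcore : ∀ p r, p.1 ≠ p.2 → J p.1 r.2 = 1 → J p.2 r.1 = 1 → s + ε ≤ e p r)
    (hle : ∀ p r, e p r ≤ 1)
    (hother : ∀ p r, s < e p r → (J p.1 r.2 = 1 ∧ J p.2 r.1 = 1) ∨
      (J p.1 r.1 = 1 ∧ J p.2 r.2 = 1)) :
    ε * (K ^ 2 - (∑ i, ∑ k, J i k * P i k) * ∑ i, ∑ k, J i k * Q i k) -
        3 * ((K - ∑ i, ∑ k, J i k * P i k) + (K - ∑ i, ∑ k, J i k * Q i k)) ≤
      ∑ p : α × α, ∑ r : β × β, (J p.2 r.1 * J p.1 r.2 - P p.2 r.1 * Q p.1 r.2) * e p r := by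
  -- Termwise form after subtracting the baseline `s`, whose total cancels. The factor 2 on the
  -- diagonal bounds `s + ε`; the last term on the left pays for exchanged endpoints.
  have hpt : ∀ (p : α × α) (r : β × β),
      ε * (J p.2 r.1 * J p.1 r.2) - ε * ((J p.2 r.1 * P p.2 r.1) * (J p.1 r.2 * Q p.1 r.2)) -
        2 * (if p.1 = p.2 then
          J p.2 r.1 * J p.1 r.2 * ((1 - P p.2 r.1) + (1 - Q p.1 r.2)) else 0) -
        Q p.1 r.2 * (1 - J p.1 r.2) * (J p.1 r.1 * J p.2 r.2) ≤
      (J p.2 r.1 * J p.1 r.2 - P p.2 r.1 * Q p.1 r.2) * e p r -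
        (s * (J p.2 r.1 * J p.1 r.2) - s * (P p.2 r.1 * Q p.1 r.2)) := by
    rintro ⟨i, j⟩ ⟨k, l⟩
    have c1 := hcore (i, j) (k, l)
    have c2 := hother (i, j) (k, l)
    have c3 := hle (i, j) (k, l)
    have c4 : i = j → e (i, j) (k, l) = 0 := by rintro rfl; exact hdiag _ _
    have c5 : i ≠ j → J j l = 1 → J i l = 0 := fun h h' => hJ.eq_zero_of_ne h h'
    simp only at c1 c2 ⊢
    generalize e (i, j) (k, l) = w at *
    by_cases hJJ : J j k = 1 ∧ J i l = 1
    · obtain ⟨h1, h2⟩ := hJJ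
      by_cases hij : i = j
      · have h0 := c4 hij
        rcases hP.zero_or_one j k with h3 | h3 <;> rcases hQ.zero_or_one i l with h4 | h4 <;>
        simp only [h1, h2, h3, h4, if_pos hij, h0] <;> linarith
      · have h0 := c1 hij h2 h1
        rcases hP.zero_or_one j k with h3 | h3 <;> rcases hQ.zero_or_one i l with h4 | h4 <;>
        simp only [h1, h2, h3, h4, if_neg hij] <;> linarith
    · have hJ0 : J j k * J i l = 0 := by
        rcases hJ.zero_or_one j k with h1 | h1 <;> rcases hJ.zero_or_one i l with h2 | h2 <;>
        simp_all
      have hJ0' : J j k * P j k * (J i l * Q i l) = 0 := by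
        rw [mul_mul_mul_comm, hJ0, zero_mul]
      rw [hJ0', hJ0]
      simp only [zero_mul, ite_self]
      have hQ0 := hQ.nonneg i l
      have hPQ0 := mul_nonneg (hP.nonneg j k) hQ0
      have hPQ1 := mul_le_of_le_one_left hQ0 (hP.le_one j k)
      have hJ1 := sub_nonneg.mpr (hJ.le_one i l)
      have hJ2 := mul_nonneg (hJ.nonneg i k) (hJ.nonneg j l)
      have hswap := mul_nonneg (mul_nonneg hQ0 hJ1) hJ2
      rcases le_or_gt w s with hw | hw
      · nlinarith
      · rcases c2 hw with h | h
        · exact absurd h.symm hJJ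
        -- A diagonal weight is zero, so it cannot exceed `s ≥ 0`; then `J i l = 0`, and the
        -- exchange term is the full `Q i l`.
        · have hij : i ≠ j := fun hij => by have := c4 hij; linarith
          rw [c5 hij h.2, h.1, h.2]
          nlinarith
  have hsum := Finset.sum_le_sum fun p (_ : p ∈ (Finset.univ : Finset (α × α))) =>
    Finset.sum_le_sum fun r (_ : r ∈ (Finset.univ : Finset (β × β))) => hpt p r
  simp only [Finset.sum_sub_distrib, ← Finset.mul_sum] at hsum
  rw [sum_sum_mul_mul J J, sum_sum_mul_mul P Q,
    sum_sum_mul_mul (fun i k => J i k * P i k) fun i k => J i k * Q i k, hJK, hPK, hQK] at hsum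
  have h1 := sum_diag_le hJ hP hQ
  have h2 := sum_swap_le hJ hQ
  simp only [mul_sub, mul_one, Finset.sum_sub_distrib, hJK, hQK] at h1 h2
  have h3 : ∑ i, ∑ k, Q i k * J i k = ∑ i, ∑ k, J i k * Q i k := by simp only [mul_comm]
  rw [h3] at h2
  have h4 := hJ.sum_mul_le hP hJK
  simp only [mul_sub, mul_one, Finset.sum_sub_distrib, sub_mul, ← pow_two] at hsum h1 h2 ⊢
  linarith

end IsPartialMatching

end Matching

/-! ### Independent groups of adjacencies and the pairs they govern -/

section Blocks

variable {m n K : ℕ}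

/-- The group containing the adjacency `i < j` of the first graph. -/
def blockFst (n K : ℕ) (i j : Fin m) (hij : i < j) : AdjBlock m n K :=
  if h : (j : ℕ) < K then .inl ⟨(⟨i, lt_trans hij h⟩, ⟨j, h⟩), hij⟩
  else .inr (.inl ⟨(i, j), hij, not_lt.mp h⟩)

/-- The group containing the adjacency `i < j` of the second graph. -/
def blockSnd (m K : ℕ) (i j : Fin n) (hij : i < j) : AdjBlock m n K :=
  if h : (j : ℕ) < K then .inl ⟨(⟨i, lt_trans hij h⟩, ⟨j, h⟩), hij⟩
  else .inr (.inr ⟨(i, j), hij, not_lt.mp h⟩)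

/-- The group containing the adjacency of the pair `p` in the first graph, if there is one. -/
def blockFst? (n K : ℕ) (p : Fin m × Fin m) : Option (AdjBlock m n K) :=
  if h : p.1 < p.2 then some (blockFst n K p.1 p.2 h)
  else if h : p.2 < p.1 then some (blockFst n K p.2 p.1 h) else none

/-- The group containing the adjacency of the pair `r` in the second graph, if there is one. -/
def blockSnd? (m K : ℕ) (r : Fin n × Fin n) : Option (AdjBlock m n K) :=
  if h : r.1 < r.2 then some (blockSnd m K r.1 r.2 h)
  else if h : r.2 < r.1 then some (blockSnd m K r.2 r.1 h) else none

/-- The pair of vertices of a group. -/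
def blockEnds : AdjBlock m n K → ℕ × ℕ
  | .inl e => (e.1.1, e.1.2)
  | .inr (.inl e) => (e.1.1, e.1.2)
  | .inr (.inr e) => (e.1.1, e.1.2)

theorem blockEnds_blockFst (i j : Fin m) (hij : i < j) :
    blockEnds (blockFst n K i j hij) = (↑i, ↑j) := by
  unfold blockFst
  split_ifs <;> rfl

theorem blockEnds_blockSnd (i j : Fin n) (hij : i < j) :
    blockEnds (blockSnd m K i j hij) = (↑i, ↑j) := by
  unfold blockSnd
  split_ifs <;> rfl

theorem blockEnds_of_blockFst?_eq {p : Fin m × Fin m} {b : AdjBlock m n K}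
    (h : blockFst? n K p = some b) :
    blockEnds b = (↑p.1, ↑p.2) ∨ blockEnds b = (↑p.2, ↑p.1) := by
  unfold blockFst? at h
  split_ifs at h with h1 h2
  · exact .inl (by rw [← Option.some.inj h, blockEnds_blockFst])
  · exact .inr (by rw [← Option.some.inj h, blockEnds_blockFst])

theorem blockEnds_of_blockSnd?_eq {r : Fin n × Fin n} {b : AdjBlock m n K}
    (h : blockSnd? m K r = some b) :
    blockEnds b = (↑r.1, ↑r.2) ∨ blockEnds b = (↑r.2, ↑r.1) := by
  unfold blockSnd? at h
  split_ifs at h with h1 h2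
  · exact .inl (by rw [← Option.some.inj h, blockEnds_blockSnd])
  · exact .inr (by rw [← Option.some.inj h, blockEnds_blockSnd])

/-- A group fixes an unordered pair of vertices, which has only two orderings. -/
theorem card_filter_le_two_of_ends {l : ℕ} {ι : Type*} [DecidableEq ι]
    (g : Fin l × Fin l → Option ι) (b : ι) (x : ℕ × ℕ)
    (h : ∀ p, g p = some b → x = (↑p.1, ↑p.2) ∨ x = (↑p.2, ↑p.1)) :
    (Finset.univ.filter fun p => g p = some b).card ≤ 2 := by
  classical
  rcases (Finset.univ.filter fun p => g p = some b).eq_empty_or_nonempty with h0 | ⟨p₀, hp₀⟩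
  · simp [h0]
  · refine (Finset.card_le_card (t := {p₀, (p₀.2, p₀.1)}) fun p hp => ?_).trans
      Finset.card_le_two
    have h1 := h p₀ (Finset.mem_filter.mp hp₀).2
    have h2 := h p (Finset.mem_filter.mp hp).2
    simp only [Finset.mem_insert, Finset.mem_singleton, Prod.ext_iff, Fin.ext_iff] at h1 h2 ⊢
    omega

theorem card_filter_blockFst?_le (b : AdjBlock m n K) :
    (Finset.univ.filter fun p => blockFst? n K p = some b).card ≤ 2 :=
  card_filter_le_two_of_ends _ b (blockEnds b) fun _ => blockEnds_of_blockFst?_eq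

theorem card_filter_blockSnd?_le (b : AdjBlock m n K) :
    (Finset.univ.filter fun r => blockSnd? m K r = some b).card ≤ 2 :=
  card_filter_le_two_of_ends _ b (blockEnds b) fun _ => blockEnds_of_blockSnd?_eq

/-- Only core groups are shared by the two graphs; the other summands of `AdjBlock` belong to one
graph each. -/
theorem lt_of_blockFst?_eq_blockSnd? {p : Fin m × Fin m} {r : Fin n × Fin n} {b : AdjBlock m n K}
    (hp : blockFst? n K p = some b) (hr : blockSnd? m K r = some b) :
    (p.1 : ℕ) < K ∧ (p.2 : ℕ) < K := by
  unfold blockFst? blockFst at hp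
  unfold blockSnd? blockSnd at hr
  have hlt : ∀ {i j : Fin m}, i < j → (j : ℕ) < K → (i : ℕ) < K := fun h h' => lt_trans h h'
  split_ifs at hp with h1 h2 h3 h4
  · exact ⟨hlt h1 h2, h2⟩
  · split_ifs at hr <;> · rw [← hr] at hp; simp at hp
  · exact ⟨h4, hlt h3 h4⟩
  · split_ifs at hr <;> · rw [← hr] at hp; simp at hp

end Blocks

/-! ### Signs as functions of independent bits, and their first two moments -/

section Model

/-- The sign `1` or `-1` of a bit. -/
noncomputable def boolSign (b : Bool) : ℝ := if b then 1 else -1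

theorem abs_boolSign_le (b : Bool) : |boolSign b| ≤ 1 := by
  cases b <;> simp [boolSign]

variable {Ω : Type*} 
open Classical in
/-- The adjacencies of a group as bits. -/
noncomputable def blockBits {m n K : ℕ} (hm : K ≤ m) (hn : K ≤ n) (G : Ω → SimpleGraph (Fin m))
    (H : Ω → SimpleGraph (Fin n)) (b : AdjBlock m n K) (ω : Ω) : Bool × Bool :=
  (decide ((adjBlockVar hm hn G H b ω).1 = 1), decide ((adjBlockVar hm hn G H b ω).2 = 1))

theorem adjInd_eq_one_iff {V : Type*} {G : Ω → SimpleGraph V} {i j : V} {ω : Ω} :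
    adjInd G i j ω = 1 ↔ (G ω).Adj i j := by
  by_cases h : (G ω).Adj i j <;> simp [adjInd, Set.indicator, h]

theorem signedAdjMatrix_self {V : Type*} (G : SimpleGraph V) (i : V) :
    signedAdjMatrix G i i = 0 := by
  simp [signedAdjMatrix]

theorem signedAdjMatrix_comm {V : Type*} (G : SimpleGraph V) (i j : V) :
    signedAdjMatrix G i j = signedAdjMatrix G j i := by
  by_cases h : i = j
  · rw [h]
  · by_cases hA : G.Adj i j
    · simp [signedAdjMatrix, h, Ne.symm h, hA, hA.symm]
    · simp [signedAdjMatrix, h, Ne.symm h, hA, mt SimpleGraph.Adj.symm hA]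

theorem abs_signedAdjMatrix_le {V : Type*} (G : SimpleGraph V) (i j : V) :
    |signedAdjMatrix G i j| ≤ 1 := by
  simp only [signedAdjMatrix, Matrix.of_apply]
  split_ifs <;> simp

theorem signedAdjMatrix_eq_adjInd {V : Type*} (G : Ω → SimpleGraph V) {i j : V} (hij : i ≠ j)
    (ω : Ω) : signedAdjMatrix (G ω) i j = 2 * adjInd G i j ω - 1 := by
  by_cases h : (G ω).Adj i j <;> simp [signedAdjMatrix, adjInd, Set.indicator, h, hij]
  norm_num

theorem boolSign_decide_adjInd {V : Type*} (G : Ω → SimpleGraph V) {i j : V} (hij : i ≠ j)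
    (ω : Ω) [Decidable (adjInd G i j ω = 1)] :
    boolSign (decide (adjInd G i j ω = 1)) = signedAdjMatrix (G ω) i j := by
  by_cases h : (G ω).Adj i j <;> simp [boolSign, signedAdjMatrix, adjInd_eq_one_iff, h, hij]

section Bits

variable {m n K : ℕ} (hm : K ≤ m) (hn : K ≤ n) (G : Ω → SimpleGraph (Fin m))
    (H : Ω → SimpleGraph (Fin n)) (ω : Ω)

theorem boolSign_blockFst {i j : Fin m} (hij : i < j) :
    boolSign (blockBits hm hn G H (blockFst n K i j hij) ω).1 = signedAdjMatrix (G ω) i j := by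
  unfold blockFst
  split_ifs <;> exact boolSign_decide_adjInd G hij.ne ω

theorem boolSign_blockSnd {i j : Fin n} (hij : i < j) :
    boolSign (blockBits hm hn G H (blockSnd m K i j hij) ω).2 = signedAdjMatrix (H ω) i j := by
  unfold blockSnd
  split_ifs <;> exact boolSign_decide_adjInd H hij.ne ω

theorem coordVal_blockFst? (p : Fin m × Fin m) :
    coordVal (fun s : Bool × Bool => boolSign s.1) (fun b => blockBits hm hn G H b ω)
      (blockFst? n K p) = signedAdjMatrix (G ω) p.1 p.2 := by
  unfold blockFst?
  split_ifs with h1 h2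
  · exact boolSign_blockFst hm hn G H ω h1
  · exact (boolSign_blockFst hm hn G H ω h2).trans (signedAdjMatrix_comm _ _ _)
  · rw [le_antisymm (not_lt.mp h2) (not_lt.mp h1), signedAdjMatrix_self]
    rfl

theorem coordVal_blockSnd? (r : Fin n × Fin n) :
    coordVal (fun s : Bool × Bool => boolSign s.2) (fun b => blockBits hm hn G H b ω)
      (blockSnd? m K r) = signedAdjMatrix (H ω) r.1 r.2 := by
  unfold blockSnd?
  split_ifs with h1 h2
  · exact boolSign_blockSnd hm hn G H ω h1
  · exact (boolSign_blockSnd hm hn G H ω h2).trans (signedAdjMatrix_comm _ _ _)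
  · rw [le_antisymm (not_lt.mp h2) (not_lt.mp h1), signedAdjMatrix_self]
    rfl

end Bits

variable [MeasurableSpace Ω] {μ : Measure Ω}

theorem measurable_adjInd {V : Type*} {G : Ω → SimpleGraph V} (hG : Measurable G) (i j : V) :
    Measurable (adjInd G i j) := by
  refine measurable_const.indicator ?_
  have h : MeasurableSet {G : SimpleGraph V | G.Adj i j} := by
    measurability
  exact hG h

theorem integral_adjInd {V : Type*} {G : Ω → SimpleGraph V} (hG : Measurable G) (i j : V) :
    ∫ ω, adjInd G i j ω ∂μ = μ.real {ω | (G ω).Adj i j} := by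
  have h : MeasurableSet {G : SimpleGraph V | G.Adj i j} := by
    measurability
  exact integral_indicator_one (hG h)

theorem measurable_signedAdjMatrix {V : Type*} {G : Ω → SimpleGraph V} (hG : Measurable G)
    (i j : V) : Measurable fun ω => signedAdjMatrix (G ω) i j := by
  by_cases hij : i = j
  · subst hij
    simp only [signedAdjMatrix_self]
    exact measurable_const
  · simp only [signedAdjMatrix_eq_adjInd G hij]
    exact ((measurable_adjInd hG i j).const_mul 2).sub_const 1

theorem measurable_blockBits {m n K : ℕ} (hm : K ≤ m) (hn : K ≤ n)
    {G : Ω → SimpleGraph (Fin m)} {H : Ω → SimpleGraph (Fin n)} (hG : Measurable G)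
    (hH : Measurable H) (b : AdjBlock m n K) : Measurable (blockBits hm hn G H b) := by
  have h1 : ∀ b, Measurable fun ω => adjBlockVar hm hn G H b ω := by
    rintro (e | e | e)
    · exact (measurable_adjInd hG _ _).prodMk (measurable_adjInd hH _ _)
    · exact (measurable_adjInd hG _ _).prodMk measurable_const
    · exact measurable_const.prodMk (measurable_adjInd hH _ _)
  have h2 : ∀ {f : Ω → ℝ}, Measurable f → Measurable fun ω => decide (f ω = 1) := fun hf =>
    measurable_to_bool (by
      convert hf (measurableSet_singleton 1) using 1
      ext ω
      simp)
  exact (h2 (h1 b).fst).prodMk (h2 (h1 b).snd)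

/-- Recoding the real-valued groups as bits gives them the finite state space needed for McDiarmid's
inequality. -/
theorem iIndepFun_blockBits {m n K : ℕ} (hm : K ≤ m) (hn : K ≤ n)
    {G : Ω → SimpleGraph (Fin m)} {H : Ω → SimpleGraph (Fin n)}
    (h : iIndepFun (adjBlockVar hm hn G H) μ) : iIndepFun (blockBits hm hn G H) μ := by
  classical
  have h2 : Measurable fun x : ℝ => decide (x = 1) := measurable_to_bool (by
      convert measurableSet_singleton (1 : ℝ) using 1
      ext ω
      simp)
  have := h.comp (fun _ x => (decide (x.1 = 1), decide (x.2 = 1)))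
    fun _ => (h2.comp measurable_fst).prodMk (h2.comp measurable_snd)
  convert this using 1
  funext b ω
  unfold blockBits
  congr

variable [IsProbabilityMeasure μ]

theorem memLp_adjInd {V : Type*} {G : Ω → SimpleGraph V} (hG : Measurable G) (i j : V) :
    MemLp (adjInd G i j) 2 μ := by
  refine MemLp.of_bound (measurable_adjInd hG i j).aestronglyMeasurable 1
    (Eventually.of_forall fun ω => ?_)
  by_cases h : (G ω).Adj i j <;> simp [adjInd, Set.indicator, h]

theorem integral_signedAdjMatrix {V : Type*} {G : Ω → SimpleGraph V} (hG : Measurable G)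
    {i j : V} (hij : i ≠ j) :
    ∫ ω, signedAdjMatrix (G ω) i j ∂μ = 2 * μ.real {ω | (G ω).Adj i j} - 1 := by
  have hi : Integrable (adjInd G i j) μ := (memLp_adjInd hG i j).integrable one_le_two
  simp only [signedAdjMatrix_eq_adjInd G hij]
  rw [integral_sub (hi.const_mul 2) (integrable_const 1), integral_const_mul, integral_adjInd hG]
  simp

theorem variance_adjInd {V : Type*} {G : Ω → SimpleGraph V} (hG : Measurable G) (i j : V) :
    variance (adjInd G i j) μ =
      μ.real {ω | (G ω).Adj i j} * (1 - μ.real {ω | (G ω).Adj i j}) := by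
  rw [variance_eq_sub (memLp_adjInd hG i j)]
  have h : adjInd G i j ^ 2 = adjInd G i j := by
    ext ω
    by_cases h : (G ω).Adj i j <;> simp [adjInd, Set.indicator, h]
  rw [h, integral_adjInd hG]
  ring

/-- Each sign is `2 * a - 1` for an indicator `a`, so the means contribute `(1-2p)²` and the
covariance, scaled by 4, contributes the rest. -/
theorem integral_mul_signedAdjMatrix {V W : Type*} {G : Ω → SimpleGraph V}
    {H : Ω → SimpleGraph W} (hG : Measurable G) (hH : Measurable H) {i j : V} {k l : W}
    (hij : i ≠ j) (hkl : k ≠ l) {p ρ : ℝ} (hp0 : 0 < p) (hp1 : p < 1)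
    (hpG : μ.real {ω | (G ω).Adj i j} = p) (hpH : μ.real {ω | (H ω).Adj k l} = p)
    (hρ : pearsonCorr (adjInd G i j) (adjInd H k l) μ = ρ) :
    ∫ ω, signedAdjMatrix (G ω) i j * signedAdjMatrix (H ω) k l ∂μ =
      (1 - 2 * p) ^ 2 + 4 * ρ * (p * (1 - p)) := by
  have hv : 0 < p * (1 - p) := mul_pos hp0 (by linarith)
  have hLG := memLp_adjInd (μ := μ) hG i j
  have hLH := memLp_adjInd (μ := μ) hH k l
  rw [pearsonCorr, variance_adjInd hG, variance_adjInd hH, hpG, hpH, Real.mul_self_sqrt hv.le,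
    div_eq_iff hv.ne', covariance_eq_sub hLG hLH, integral_adjInd hG, integral_adjInd hH, hpG,
    hpH] at hρ
  have hi : Integrable (adjInd G i j) μ := hLG.integrable one_le_two
  have hj : Integrable (adjInd H k l) μ := hLH.integrable one_le_two
  have hm : Integrable (adjInd G i j * adjInd H k l) μ := hLG.integrable_mul hLH
  have i1 : Integrable (fun ω => 4 * (adjInd G i j * adjInd H k l) ω - 2 * adjInd G i j ω) μ :=
    (hm.const_mul 4).sub (hi.const_mul 2)
  have i2 : Integrable (fun ω => 4 * (adjInd G i j * adjInd H k l) ω - 2 * adjInd G i j ω -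
    2 * adjInd H k l ω) μ := i1.sub (hj.const_mul 2)
  have h1 : ∀ ω, signedAdjMatrix (G ω) i j * signedAdjMatrix (H ω) k l =
      4 * (adjInd G i j * adjInd H k l) ω - 2 * adjInd G i j ω - 2 * adjInd H k l ω + 1 := by
    intro ω
    rw [signedAdjMatrix_eq_adjInd G hij, signedAdjMatrix_eq_adjInd H hkl, Pi.mul_apply]
    ring
  simp only [h1]
  rw [integral_add i2 (integrable_const 1), integral_sub i1 (hj.const_mul 2),
    integral_sub (hm.const_mul 4) (hi.const_mul 2), integral_const_mul, integral_const_mul,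
    integral_const_mul, integral_adjInd hG, integral_adjInd hH, hpG, hpH]
  simp only [integral_const, probReal_univ, smul_eq_mul, mul_one]
  linarith

variable {M : ModelParams} {G : Ω → SimpleGraph (Fin M.m)} {H : Ω → SimpleGraph (Fin M.n)}
  {q ε : ℝ}

namespace IsCorrelatedBernoulli

theorem le_integral_core_of_lt (hM : IsCorrelatedBernoulli μ M G H)
    (hq0 : 0 < q)
    (hp : ∀ i j, i < j → j < max M.m M.n → M.p i j ∈ Set.Icc q (1 - q))
    (hrho : ∀ i j, i < j → j < M.K → (1 - 2 * q) ^ 2 + ε ≤ M.rho i j)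
    {i j : Fin M.m} {k l : Fin M.n} (hij : i < j) (hjK : (j : ℕ) < M.K) (hik : (i : ℕ) = k)
    (hjl : (j : ℕ) = l) :
    (1 - 2 * q) ^ 2 + ε ≤ ∫ ω, signedAdjMatrix (G ω) i j * signedAdjMatrix (H ω) k l ∂μ := by
  have hij' : (i : ℕ) < j := hij
  have hkl : k < l := by rw [Fin.lt_def, ← hik, ← hjl]; exact hij
  have hP := hp i j hij (lt_max_of_lt_left j.2)
  have hR := hrho i j hij hjK
  have hR1 := (M.rho_mem i j hij hjK).2
  have hpH := hM.prob_H k l hkl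
  rw [← hik, ← hjl] at hpH
  have hc := hM.corr ⟨i, hij'.trans hjK⟩ ⟨j, hjK⟩ hij
  have e1 : Fin.castLE M.K_le_n ⟨i, hij'.trans hjK⟩ = k := Fin.ext hik
  have e2 : Fin.castLE M.K_le_n ⟨j, hjK⟩ = l := Fin.ext hjl
  rw [e1, e2] at hc
  rw [integral_mul_signedAdjMatrix hM.measurable_G hM.measurable_H hij.ne hkl.ne
    (by linarith [hP.1]) (by linarith [hP.2]) (hM.prob_G i j hij) hpH hc]
  simp only
  -- Since `4p(1-p) = 1 - (1-2p)²`, the expectation equals `ρ + (1-ρ)(1-2p)²`, which is at least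
  -- `ρ`.
  nlinarith [mul_nonneg (sub_nonneg.mpr hR1) (sq_nonneg (1 - 2 * M.p i j))]

theorem le_integral_core (hM : IsCorrelatedBernoulli μ M G H)
    (hq0 : 0 < q)
    (hp : ∀ i j, i < j → j < max M.m M.n → M.p i j ∈ Set.Icc q (1 - q))
    (hrho : ∀ i j, i < j → j < M.K → (1 - 2 * q) ^ 2 + ε ≤ M.rho i j)
    {i j : Fin M.m} {k l : Fin M.n} (hij : i ≠ j) (hiK : (i : ℕ) < M.K) (hjK : (j : ℕ) < M.K)
    (hik : (i : ℕ) = k) (hjl : (j : ℕ) = l) :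
    (1 - 2 * q) ^ 2 + ε ≤ ∫ ω, signedAdjMatrix (G ω) i j * signedAdjMatrix (H ω) k l ∂μ := by
  rcases lt_or_gt_of_ne hij with h | h
  · exact hM.le_integral_core_of_lt hq0 hp hrho h hjK hik hjl
  · have := hM.le_integral_core_of_lt hq0 hp hrho h hiK hjl hik
    simpa only [signedAdjMatrix_comm _ j i, signedAdjMatrix_comm _ l k] using this

theorem abs_integral_fst_le (hM : IsCorrelatedBernoulli μ M G H)
    (hp : ∀ i j, i < j → j < max M.m M.n → M.p i j ∈ Set.Icc q (1 - q)) {i j : Fin M.m}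
    (hij : i ≠ j) : |∫ ω, signedAdjMatrix (G ω) i j ∂μ| ≤ 1 - 2 * q := by
  wlog h : i < j generalizing i j
  · have := this hij.symm (lt_of_le_of_ne (not_lt.mp h) hij.symm)
    simpa only [signedAdjMatrix_comm _ j i] using this
  have hP := hp i j h (lt_max_of_lt_left j.2)
  rw [integral_signedAdjMatrix hM.measurable_G hij, hM.prob_G i j h, abs_le]
  constructor <;> linarith [hP.1, hP.2]

theorem abs_integral_snd_le (hM : IsCorrelatedBernoulli μ M G H)
    (hp : ∀ i j, i < j → j < max M.m M.n → M.p i j ∈ Set.Icc q (1 - q)) {i j : Fin M.n}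
    (hij : i ≠ j) : |∫ ω, signedAdjMatrix (H ω) i j ∂μ| ≤ 1 - 2 * q := by
  wlog h : i < j generalizing i j
  · have := this hij.symm (lt_of_le_of_ne (not_lt.mp h) hij.symm)
    simpa only [signedAdjMatrix_comm _ j i] using this
  have hP := hp i j h (lt_max_of_lt_right j.2)
  rw [integral_signedAdjMatrix hM.measurable_H hij, hM.prob_H i j h, abs_le]
  constructor <;> linarith [hP.1, hP.2]

/-- Signs in different groups are independent, so their expected product factors into means of
modulus at most `1 - 2q`; only a common group can exceed the threshold. -/
theorem exists_block_of_lt_integral (hM : IsCorrelatedBernoulli μ M G H)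
    (hp : ∀ i j, i < j → j < max M.m M.n → M.p i j ∈ Set.Icc q (1 - q))
    (p : Fin M.m × Fin M.m) (r : Fin M.n × Fin M.n)
    (h : (1 - 2 * q) ^ 2 <
      ∫ ω, signedAdjMatrix (G ω) p.1 p.2 * signedAdjMatrix (H ω) r.1 r.2 ∂μ) :
    ∃ b, blockFst? M.n M.K p = some b ∧ blockSnd? M.m M.K r = some b := by
  have hs := sq_nonneg (1 - 2 * q)
  have hp' : p.1 ≠ p.2 := fun he => by
    rw [he] at h
    simp only [signedAdjMatrix_self, zero_mul, integral_zero] at h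
    linarith
  have hr' : r.1 ≠ r.2 := fun he => by
    rw [he] at h
    simp only [signedAdjMatrix_self, mul_zero, integral_zero] at h
    linarith
  obtain ⟨b, hb⟩ : ∃ b, blockFst? M.n M.K p = some b := by
    unfold blockFst?
    rcases lt_or_gt_of_ne hp' with h1 | h1
    · exact ⟨_, dif_pos h1⟩
    · exact ⟨_, by rw [dif_neg h1.not_gt, dif_pos h1]⟩
  obtain ⟨b', hb'⟩ : ∃ b, blockSnd? M.m M.K r = some b := by
    unfold blockSnd?
    rcases lt_or_gt_of_ne hr' with h1 | h1
    · exact ⟨_, dif_pos h1⟩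
    · exact ⟨_, by rw [dif_neg h1.not_gt, dif_pos h1]⟩
  by_cases hbb : b = b'
  · exact ⟨b, hb, hbb ▸ hb'⟩
  · exfalso
    have hind := ((iIndepFun_blockBits _ _ hM.indep).indepFun hbb).comp
      (φ := fun s => boolSign s.1) (ψ := fun s => boolSign s.2) (measurable_of_finite _)
      (measurable_of_finite _)
    have e1 : (fun s : Bool × Bool => boolSign s.1) ∘ blockBits M.K_le_m M.K_le_n G H b =
        fun ω => signedAdjMatrix (G ω) p.1 p.2 := by
      funext ω
      rw [← coordVal_blockFst? M.K_le_m M.K_le_n G H ω p, hb]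
      rfl
    have e2 : (fun s : Bool × Bool => boolSign s.2) ∘ blockBits M.K_le_m M.K_le_n G H b' =
        fun ω => signedAdjMatrix (H ω) r.1 r.2 := by
      funext ω
      rw [← coordVal_blockSnd? M.K_le_m M.K_le_n G H ω r, hb']
      rfl
    rw [e1, e2] at hind
    rw [hind.integral_fun_mul_eq_mul_integral
      (measurable_signedAdjMatrix hM.measurable_G _ _).aestronglyMeasurable
      (measurable_signedAdjMatrix hM.measurable_H _ _).aestronglyMeasurable] at h
    have h1 := hM.abs_integral_fst_le hp hp'
    have h2 := hM.abs_integral_snd_le hp hr'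
    have h3 := mul_le_mul h1 h2 (abs_nonneg _) ((abs_nonneg _).trans h1)
    rw [← abs_mul] at h3
    linarith [le_abs_self ((∫ ω, signedAdjMatrix (G ω) p.1 p.2 ∂μ) *
      ∫ ω, signedAdjMatrix (H ω) r.1 r.2 ∂μ)]

end IsCorrelatedBernoulli

end Model

/-! ### The trace objective, the core matrix, and encoding by flipped entries -/

theorem Matrix.trace_mul_mul_mul_transpose {α β : Type*} [Fintype α] [Fintype β]
    (A : Matrix α α ℝ) (P Q : Matrix α β ℝ) (B : Matrix β β ℝ) :
    Matrix.trace (A * P * B * Q.transpose) =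
      ∑ p : α × α, ∑ r : β × β, P p.2 r.1 * Q p.1 r.2 * (A p.1 p.2 * B r.1 r.2) := by
  simp only [Fintype.sum_prod_type, Matrix.trace, Matrix.diag, Matrix.mul_apply,
    Matrix.transpose_apply, Finset.sum_mul]
  refine Finset.sum_congr rfl fun i _ => ?_
  calc ∑ l, ∑ k, ∑ j, A i j * P j k * B k l * Q i l
      = ∑ l, ∑ j, ∑ k, A i j * P j k * B k l * Q i l :=
        Finset.sum_congr rfl fun l _ => Finset.sum_comm
    _ = ∑ j, ∑ l, ∑ k, A i j * P j k * B k l * Q i l := Finset.sum_comm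
    _ = ∑ j, ∑ k, ∑ l, P j k * Q i l * (A i j * B k l) := by
        refine Finset.sum_congr rfl fun j _ => ?_
        rw [Finset.sum_comm]
        exact Finset.sum_congr rfl fun k _ => Finset.sum_congr rfl fun l _ => by ring

section Core

variable {m n K : ℕ}

theorem isPartialMatching_of_mem {X : Matrix (Fin m) (Fin n) ℝ}
    (hX : X ∈ matchingMatrices m n K) : IsPartialMatching X :=
  ⟨hX.1, hX.2.1, hX.2.2.1⟩

theorem coreMatrix_eq_one_iff {i : Fin m} {j : Fin n} :
    coreMatrix m n K i j = 1 ↔ (i : ℕ) = j ∧ (i : ℕ) < K := by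
  simp [coreMatrix]

theorem sum_coreMatrix_row (hn : K ≤ n) (i : Fin m) :
    ∑ j, coreMatrix m n K i j = if (i : ℕ) < K then 1 else 0 := by
  simp only [coreMatrix, Matrix.of_apply]
  split_ifs with h
  · rw [Finset.sum_eq_single (⟨i, h.trans_le hn⟩ : Fin n)]
    · simp [h]
    · intro j _ hj
      rw [if_neg]
      rintro ⟨h1, -⟩
      exact hj (Fin.ext h1.symm)
    · simp
  · simp [h]

theorem sum_coreMatrix_col_le (j : Fin n) : ∑ i, coreMatrix m n K i j ≤ 1 := by
  simp only [coreMatrix, Matrix.of_apply]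
  rw [Finset.sum_boole]
  refine Nat.cast_le_one.mpr (Finset.card_le_one.mpr fun a ha b hb => ?_)
  simp only [Finset.mem_filter, Finset.mem_univ, true_and] at ha hb
  exact Fin.ext (ha.1.trans hb.1.symm)

theorem coreMatrix_mem (hm : K ≤ m) (hn : K ≤ n) :
    coreMatrix m n K ∈ matchingMatrices m n K := by
  refine ⟨fun i j => ?_, fun i => ?_, sum_coreMatrix_col_le, ?_⟩
  · simp only [coreMatrix, Matrix.of_apply]
    split_ifs <;> simp
  · rw [sum_coreMatrix_row hn]
    split_ifs <;> norm_num
  · simp only [sum_coreMatrix_row hn]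
    rw [Fin.sum_univ_eq_sum_range (fun i => if i < K then (1 : ℝ) else 0) m, ← Finset.sum_filter]
    have : (Finset.range m).filter (· < K) = Finset.range K := by
      ext i
      simp only [Finset.mem_filter, Finset.mem_range]
      omega
    rw [this]
    simp

/-- The matrix obtained from a matrix `J` by replacing the entries `x` in `T` with `1 - x`. -/
def flipEntries {α β : Type*} [DecidableEq α] [DecidableEq β] (J : Matrix α β ℝ)
    (T : Finset (α × β)) : Matrix α β ℝ :=
  Matrix.of fun i j => if (i, j) ∈ T then 1 - J i j else J i j

theorem exists_flipEntries_eq {α β : Type*} [Fintype α] [Fintype β] [DecidableEq α]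
    [DecidableEq β] {J P : Matrix α β ℝ} (hJ : ∀ i j, J i j = 0 ∨ J i j = 1)
    (hP : ∀ i j, P i j = 0 ∨ P i j = 1) : ∃ T, flipEntries J T = P := by
  classical
  refine ⟨Finset.univ.filter fun x => P x.1 x.2 ≠ J x.1 x.2, ?_⟩
  ext i j
  simp only [flipEntries, Matrix.of_apply, Finset.mem_filter, Finset.mem_univ, true_and]
  rcases hJ i j with h1 | h1 <;> rcases hP i j with h2 | h2 <;> simp [h1, h2]

theorem flipEntries_empty {α β : Type*} [DecidableEq α] [DecidableEq β] (J : Matrix α β ℝ) :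
    flipEntries J ∅ = J := by
  ext i j
  simp [flipEntries]

/-- `T` is the symmetric difference of the two supports. -/
theorem card_eq_of_flipEntries {α β : Type*} [Fintype α] [Fintype β] [DecidableEq α]
    [DecidableEq β] {J : Matrix α β ℝ} (hJ : ∀ i j, J i j = 0 ∨ J i j = 1) (T : Finset (α × β)) :
    (T.card : ℝ) = ∑ i, ∑ k, J i k + ∑ i, ∑ k, flipEntries J T i k -
      2 * ∑ i, ∑ k, J i k * flipEntries J T i k := by
  have h1 : (T.card : ℝ) = ∑ x : α × β, if x ∈ T then (1 : ℝ) else 0 := by simp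
  rw [h1, Fintype.sum_prod_type]
  simp only [Finset.mul_sum, ← Finset.sum_add_distrib, ← Finset.sum_sub_distrib]
  refine Finset.sum_congr rfl fun i _ => Finset.sum_congr rfl fun k _ => ?_
  simp only [flipEntries, Matrix.of_apply]
  rcases hJ i k with h | h <;> split_ifs <;> rw [h] <;> norm_num

end Core

/-! ### Failure probability of one pair and the union bound -/

section Tail

variable {Ω : Type*} [MeasurableSpace Ω] {μ : Measure Ω} [IsProbabilityMeasure μ]
  {M : ModelParams} {G : Ω → SimpleGraph (Fin M.m)} {H : Ω → SimpleGraph (Fin M.n)} {q ε : ℝ}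

namespace IsCorrelatedBernoulli

theorem integral_bilinear (hM : IsCorrelatedBernoulli μ M G H)
    (c : Fin M.m × Fin M.m → Fin M.n × Fin M.n → ℝ) :
    ∫ ω, ∑ p, ∑ r, c p r * (signedAdjMatrix (G ω) p.1 p.2 * signedAdjMatrix (H ω) r.1 r.2) ∂μ =
      ∑ p, ∑ r, c p r *
        ∫ ω, signedAdjMatrix (G ω) p.1 p.2 * signedAdjMatrix (H ω) r.1 r.2 ∂μ := by
  have hi : ∀ (p : Fin M.m × Fin M.m) (r : Fin M.n × Fin M.n), Integrable (fun ω => c p r *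
      (signedAdjMatrix (G ω) p.1 p.2 * signedAdjMatrix (H ω) r.1 r.2)) μ := by
    intro p r
    refine Integrable.const_mul (Integrable.of_bound
      ((measurable_signedAdjMatrix hM.measurable_G _ _).mul
        (measurable_signedAdjMatrix hM.measurable_H _ _)).aestronglyMeasurable 1
      (Eventually.of_forall fun ω => ?_)) _
    rw [Pi.mul_apply, Real.norm_eq_abs, abs_mul]
    exact mul_le_one₀ (abs_signedAdjMatrix_le _ _ _) (abs_nonneg _) (abs_signedAdjMatrix_le _ _ _)
  rw [integral_finsetSum _ fun p _ => integrable_finsetSum _ fun r _ => hi p r]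
  refine Finset.sum_congr rfl fun p _ => ?_
  rw [integral_finsetSum _ fun r _ => hi p r]
  exact Finset.sum_congr rfl fun r _ => integral_const_mul _ _

theorem integral_mul_le_one (p : Fin M.m × Fin M.m) (r : Fin M.n × Fin M.n) :
    ∫ ω, signedAdjMatrix (G ω) p.1 p.2 * signedAdjMatrix (H ω) r.1 r.2 ∂μ ≤ 1 := by
  refine (le_abs_self _).trans ?_
  have := norm_integral_le_of_norm_le_const (μ := μ) (C := 1)
    (f := fun ω => signedAdjMatrix (G ω) p.1 p.2 * signedAdjMatrix (H ω) r.1 r.2)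
    (Eventually.of_forall fun ω => by
      rw [Real.norm_eq_abs, abs_mul]
      exact mul_le_one₀ (abs_signedAdjMatrix_le _ _ _) (abs_nonneg _)
        (abs_signedAdjMatrix_le _ _ _))
  simpa using this

theorem gap_le_integral (hM : IsCorrelatedBernoulli μ M G H) (hq0 : 0 < q) (hq1 : q < 1 / 2)
    (hp : ∀ i j, i < j → j < max M.m M.n → M.p i j ∈ Set.Icc q (1 - q))
    (hrho : ∀ i j, i < j → j < M.K → (1 - 2 * q) ^ 2 + ε ≤ M.rho i j)
    (hε1 : ε ≤ 1) {J P Q : Matrix (Fin M.m) (Fin M.n) ℝ} (hJ : J = coreMatrix M.m M.n M.K)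
    (hP : P ∈ matchingMatrices M.m M.n M.K) (hQ : Q ∈ matchingMatrices M.m M.n M.K) :
    ε * ((M.K : ℝ) ^ 2 - (∑ i, ∑ k, J i k * P i k) * ∑ i, ∑ k, J i k * Q i k) -
        3 * ((M.K - ∑ i, ∑ k, J i k * P i k) + (M.K - ∑ i, ∑ k, J i k * Q i k)) ≤
      ∫ ω, ∑ p : Fin M.m × Fin M.m, ∑ r : Fin M.n × Fin M.n,
        (J p.2 r.1 * J p.1 r.2 - P p.2 r.1 * Q p.1 r.2) *
          (signedAdjMatrix (G ω) p.1 p.2 * signedAdjMatrix (H ω) r.1 r.2) ∂μ := by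
  have hJm : J ∈ matchingMatrices M.m M.n M.K := hJ ▸ coreMatrix_mem M.K_le_m M.K_le_n
  rw [hM.integral_bilinear fun p r => J p.2 r.1 * J p.1 r.2 - P p.2 r.1 * Q p.1 r.2]
  refine (isPartialMatching_of_mem hJm).gap_le_sum (isPartialMatching_of_mem hP)
    (isPartialMatching_of_mem hQ) hJm.2.2.2 hP.2.2.2 hQ.2.2.2
    (fun p r => ∫ ω, signedAdjMatrix (G ω) p.1 p.2 * signedAdjMatrix (H ω) r.1 r.2 ∂μ)
    (s := (1 - 2 * q) ^ 2) (sq_nonneg _) (by nlinarith) hε1 ?_ ?_ ?_ ?_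
  · intro i r
    simp [signedAdjMatrix_self]
  · intro p r hne h1 h2
    rw [hJ, coreMatrix_eq_one_iff] at h1 h2
    -- In the trace, `J` matches `p.1` with `r.2` and `p.2` with `r.1`, so the symmetry of `B` is
    -- needed to see the same edge.
    have := hM.le_integral_core hq0 hp hrho (k := r.2) (l := r.1) hne h1.2 h2.2 h1.1 h2.1
    simpa only [signedAdjMatrix_comm _ r.2 r.1] using this
  · exact integral_mul_le_one
  · intro p r h
    obtain ⟨b, h1, h2⟩ := hM.exists_block_of_lt_integral hp p r h
    have h3 := lt_of_blockFst?_eq_blockSnd? h1 h2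
    have h4 := blockEnds_of_blockFst?_eq h1
    have h5 := blockEnds_of_blockSnd?_eq h2
    simp only [hJ, coreMatrix_eq_one_iff]
    simp only [Prod.ext_iff] at h4 h5
    omega

/-- The probability that `(P, Q)` is at least as good as the true alignment. -/
theorem measureReal_trace_le (hM : IsCorrelatedBernoulli μ M G H) (hq0 : 0 < q) (hq1 : q < 1 / 2)
    (hp : ∀ i j, i < j → j < max M.m M.n → M.p i j ∈ Set.Icc q (1 - q))
    (hrho : ∀ i j, i < j → j < M.K → (1 - 2 * q) ^ 2 + ε ≤ M.rho i j)
    (hε0 : 0 ≤ ε) (hε1 : ε ≤ 1) (hεK : 12 ≤ ε * M.K) {J P Q : Matrix (Fin M.m) (Fin M.n) ℝ}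
    (hJ : J = coreMatrix M.m M.n M.K)
    (hP : P ∈ matchingMatrices M.m M.n M.K) (hQ : Q ∈ matchingMatrices M.m M.n M.K) {d : ℝ}
    (hd : (M.K - ∑ i, ∑ k, J i k * P i k) + (M.K - ∑ i, ∑ k, J i k * Q i k) = d) (hd0 : 0 < d) :
    μ.real {ω | Matrix.trace (signedAdjMatrix (G ω) * J * signedAdjMatrix (H ω) * J.transpose) ≤
      Matrix.trace (signedAdjMatrix (G ω) * P * signedAdjMatrix (H ω) * Q.transpose)} ≤
      Real.exp (-(ε ^ 2 * M.K * d / 2048)) := by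
  have hJm : J ∈ matchingMatrices M.m M.n M.K := hJ ▸ coreMatrix_mem M.K_le_m M.K_le_n
  have hJ' := isPartialMatching_of_mem hJm
  have hP' := isPartialMatching_of_mem hP
  have hQ' := isPartialMatching_of_mem hQ
  have habs := hJ'.sum_abs_eq hP' hQ' hJm.2.2.2 hP.2.2.2 hQ.2.2.2
  have hgap := hM.gap_le_integral hq0 hq1 hp hrho hε1 hJ hP hQ
  have hxK := hJ'.sum_mul_le hP' hJm.2.2.2
  have hyK := hJ'.sum_mul_le hQ' hJm.2.2.2
  have hx0 := hJ'.sum_mul_nonneg hP'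
  have hy0 := hJ'.sum_mul_nonneg hQ'
  rw [hd] at hgap
  generalize ∑ i, ∑ k, J i k * P i k = x at *
  generalize ∑ i, ∑ k, J i k * Q i k = y at *
  have hK0 : (0 : ℝ) < M.K := Nat.cast_pos.mpr M.K_pos
  obtain ⟨N, hN⟩ : ∃ N, N = (M.K : ℝ) ^ 2 - x * y := ⟨_, rfl⟩
  rw [← hN] at habs hgap
  -- The difference of the two sides is `x(K-y) + y(K-x)`.
  have hKN : M.K * d ≤ 2 * N := by
    rw [hN, ← hd]
    nlinarith
  have hKd : 0 < M.K * d := mul_pos hK0 hd0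
  have hN0 : 0 < N := by linarith
  -- This is where `εK ≥ 12` enters: it gives `12d ≤ 2εN`, so the error `3d` takes at most half of
  -- the main term.
  have hE : ε * N / 2 ≤ ε * N - 3 * d := by
    have h1 : 12 * d ≤ ε * (M.K * d) := by
      rw [← mul_assoc]
      exact mul_le_mul_of_nonneg_right hεK hd0.le
    have h2 : ε * (M.K * d) ≤ ε * (2 * N) := mul_le_mul_of_nonneg_left hKN hε0
    linarith
  have htr : ∀ ω, Matrix.trace (signedAdjMatrix (G ω) * J * signedAdjMatrix (H ω) * J.transpose) -
      Matrix.trace (signedAdjMatrix (G ω) * P * signedAdjMatrix (H ω) * Q.transpose) =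
      ∑ p : Fin M.m × Fin M.m, ∑ r : Fin M.n × Fin M.n,
        (J p.2 r.1 * J p.1 r.2 - P p.2 r.1 * Q p.1 r.2) *
          (signedAdjMatrix (G ω) p.1 p.2 * signedAdjMatrix (H ω) r.1 r.2) := by
    intro ω
    rw [Matrix.trace_mul_mul_mul_transpose, Matrix.trace_mul_mul_mul_transpose]
    simp only [sub_mul, Finset.sum_sub_distrib]
  have key := iIndepFun.measureReal_bilinear_nonpos_le (iIndepFun_blockBits _ _ hM.indep)
    (measurable_blockBits _ _ hM.measurable_G hM.measurable_H)
    (fun p r => J p.2 r.1 * J p.1 r.2 - P p.2 r.1 * Q p.1 r.2)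
    (blockFst? M.n M.K) (blockSnd? M.m M.K) (fun s => boolSign s.1) (fun s => boolSign s.2)
    (fun s => abs_boolSign_le s.1) (fun s => abs_boolSign_le s.2)
    (hJ'.sum_abs_row_le hP' hQ') (hJ'.sum_abs_col_le hP' hQ') card_filter_blockFst?_le
    card_filter_blockSnd?_le (2 * N) (ε * N / 2) habs.le (by linarith)
    (div_nonneg (mul_nonneg hε0 hN0.le) zero_le_two) (by
      simp only [coordVal_blockFst?, coordVal_blockSnd?]
      exact hE.trans hgap)
  simp only [coordVal_blockFst?, coordVal_blockSnd?, ← htr, sub_nonpos] at key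
  refine key.trans (Real.exp_le_exp.mpr (neg_le_neg ?_))
  have h1 : (ε * N / 2) ^ 2 / (128 * (2 * N)) = ε ^ 2 * N / 1024 := by
    field_simp
    ring
  rw [h1]
  have := mul_le_mul_of_nonneg_left hKN (sq_nonneg ε)
  linarith

end IsCorrelatedBernoulli

theorem sum_nonempty_pow_card {κ : Type*} [Fintype κ] [DecidableEq κ] (y : ℝ) :
    ∑ T ∈ (Finset.univ : Finset (Finset κ)).erase ∅, y ^ T.card =
      (1 + y) ^ Fintype.card κ - 1 := by
  have h := Finset.sum_pow_mul_eq_add_pow y 1 (Finset.univ : Finset κ)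
  simp only [one_pow, mul_one, Finset.powerset_univ] at h
  rw [← Finset.add_sum_erase _ _ (Finset.mem_univ ∅)] at h
  simp only [Finset.card_empty, pow_zero, Finset.card_univ] at h
  rw [add_comm 1 y]
  linarith

theorem argMaxOn_eq_singleton {α : Type*} {f : α → ℝ} {s : Set α} {a : α} (ha : a ∈ s)
    (h : ∀ b ∈ s, b ≠ a → f b < f a) : argMaxOn f s = {a} := by
  ext b
  simp only [argMaxOn, Set.mem_ofPred_eq, Set.mem_singleton_iff]
  constructor
  · rintro ⟨hb, hmax⟩
    by_contra hne
    exact absurd (hmax a ha) (not_le.mpr (h b hb hne))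
  · rintro rfl
    refine ⟨ha, fun y hy => ?_⟩
    by_cases hne : y = b
    · rw [hne]
    · exact (h y hy hne).le

namespace IsCorrelatedBernoulli

/-- The probability that the true alignment is not the unique maximizer. -/
theorem measureReal_argMaxOn_ne_le (hM : IsCorrelatedBernoulli μ M G H) (hq0 : 0 < q)
    (hq1 : q < 1 / 2) (hp : ∀ i j, i < j → j < max M.m M.n → M.p i j ∈ Set.Icc q (1 - q))
    (hrho : ∀ i j, i < j → j < M.K → (1 - 2 * q) ^ 2 + ε ≤ M.rho i j)
    (hε0 : 0 ≤ ε) (hε1 : ε ≤ 1) (hεK : 12 ≤ ε * M.K) :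
    μ.real {ω | argMaxOn
        (fun PQ : Matrix (Fin M.m) (Fin M.n) ℝ × Matrix (Fin M.m) (Fin M.n) ℝ =>
          Matrix.trace (signedAdjMatrix (G ω) * PQ.1 * signedAdjMatrix (H ω) * PQ.2.transpose))
        (matchingMatrices M.m M.n M.K ×ˢ matchingMatrices M.m M.n M.K) ≠
      {(coreMatrix M.m M.n M.K, coreMatrix M.m M.n M.K)}} ≤
      (1 + Real.exp (-(ε ^ 2 * M.K / 4096))) ^ (2 * (M.m * M.n)) - 1 := by
  classical
  have hJ := coreMatrix_mem M.K_le_m M.K_le_n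
  set J := coreMatrix M.m M.n M.K with hJdef
  let f : Ω → Matrix (Fin M.m) (Fin M.n) ℝ → Matrix (Fin M.m) (Fin M.n) ℝ → ℝ := fun ω P Q =>
    Matrix.trace (signedAdjMatrix (G ω) * P * signedAdjMatrix (H ω) * Q.transpose)
  -- The two summands of the index type record the flips producing `P` and `Q`. Sets not encoding a
  -- pair of matchings give the empty event, so the union may run over all nonempty `T`.
  let bad : Finset (Fin M.m × Fin M.n ⊕ Fin M.m × Fin M.n) → Set Ω := fun T =>
    {ω | (flipEntries J T.toLeft ∈ matchingMatrices M.m M.n M.K ∧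
      flipEntries J T.toRight ∈ matchingMatrices M.m M.n M.K) ∧
      f ω J J ≤ f ω (flipEntries J T.toLeft) (flipEntries J T.toRight)}
  have hbad : ∀ T, T ≠ ∅ → μ.real (bad T) ≤ Real.exp (-(ε ^ 2 * M.K / 4096)) ^ T.card := by
    intro T hT
    by_cases hmem : flipEntries J T.toLeft ∈ matchingMatrices M.m M.n M.K ∧
      flipEntries J T.toRight ∈ matchingMatrices M.m M.n M.K
    · have h1 := card_eq_of_flipEntries hJ.1 T.toLeft
      have h2 := card_eq_of_flipEntries hJ.1 T.toRight
      rw [hJ.2.2.2, hmem.1.2.2.2] at h1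
      rw [hJ.2.2.2, hmem.2.2.2.2] at h2
      have h3 : (T.toLeft.card : ℝ) + T.toRight.card = T.card := by
        exact_mod_cast T.card_toLeft_add_card_toRight
      have h4 : (0 : ℝ) < T.card :=
        Nat.cast_pos.mpr (Finset.card_pos.mpr (Finset.nonempty_iff_ne_empty.mpr hT))
      have h5 := hM.measureReal_trace_le hq0 hq1 hp hrho hε0 hε1 hεK hJdef hmem.1 hmem.2
        (d := T.card / 2) (by linarith) (by linarith)
      refine (measureReal_mono fun ω hω => hω.2).trans (h5.trans (le_of_eq ?_))
      rw [← Real.exp_nat_mul]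
      congr 1
      ring
    · have : bad T = ∅ := Set.eq_empty_of_forall_notMem fun ω hω => hmem hω.1
      rw [this, measureReal_empty]
      positivity
  have hcard : Fintype.card (Fin M.m × Fin M.n ⊕ Fin M.m × Fin M.n) = 2 * (M.m * M.n) := by
    simp [two_mul]
  rw [← hcard, ← sum_nonempty_pow_card]
  refine le_trans ?_ (Finset.sum_le_sum fun T hT => hbad T (Finset.ne_of_mem_erase hT))
  refine le_trans (measureReal_mono (fun ω hω => ?_) (measure_ne_top μ _))
    (measureReal_biUnion_finset_le _ bad)
  by_contra hnot
  refine hω (argMaxOn_eq_singleton ⟨hJ, hJ⟩ ?_)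
  rintro ⟨P, Q⟩ ⟨hP, hQ⟩ hne
  obtain ⟨S, rfl⟩ := exists_flipEntries_eq hJ.1 hP.1
  obtain ⟨T, rfl⟩ := exists_flipEntries_eq hJ.1 hQ.1
  by_contra hlt
  refine hnot (Set.mem_biUnion (x := S.disjSum T) ?_ ?_)
  · simp only [Finset.coe_erase, Finset.coe_univ, Set.mem_sdiff, Set.mem_univ, true_and,
      Set.mem_singleton_iff, Finset.disjSum_eq_empty]
    rintro ⟨rfl, rfl⟩
    simp [flipEntries_empty] at hne
  · simp only [bad, Set.mem_ofPred_eq, Finset.toLeft_disjSum, Finset.toRight_disjSum]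
    exact ⟨⟨hP, hQ⟩, not_lt.mp hlt⟩

end IsCorrelatedBernoulli

end Tail

/-! ### Summability and Borel–Cantelli -/

section Limit

theorem ModelParams.eps_le {M : ModelParams} {q : ℝ}
    (h : ∀ i j, i < j → j < M.K → (1 - 2 * q) ^ 2 < M.rho i j) {i j : ℕ} (hij : i < j)
    (hj : j < M.K) : (1 - 2 * q) ^ 2 + M.eps q ≤ M.rho i j := by
  have : M.eps q ≤ M.rho i j - (1 - 2 * q) ^ 2 := by
    refine csInf_le ⟨0, ?_⟩ ⟨i, j, hij, hj, rfl⟩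
    rintro x ⟨a, b, hab, hb, rfl⟩
    exact sub_nonneg.mpr (h a b hab hb).le
  linarith

theorem ModelParams.eps_nonneg {M : ModelParams} {q : ℝ}
    (h : ∀ i j, i < j → j < M.K → (1 - 2 * q) ^ 2 < M.rho i j) : 0 ≤ M.eps q := by
  refine Real.sInf_nonneg ?_
  rintro x ⟨a, b, hab, hb, rfl⟩
  exact sub_nonneg.mpr (h a b hab hb).le

/-- One core pair suffices, as `ρ ≤ 1`; for `K = 1` the infimum of the empty set is `0`. -/
theorem ModelParams.eps_le_one {M : ModelParams} {q : ℝ}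
    (h : ∀ i j, i < j → j < M.K → (1 - 2 * q) ^ 2 < M.rho i j) : M.eps q ≤ 1 := by
  by_cases hK : 1 < M.K
  · have h1 := M.eps_le h zero_lt_one hK
    have h2 := (M.rho_mem 0 1 zero_lt_one hK).2
    linarith [sq_nonneg (1 - 2 * q)]
  · have : {x : ℝ | ∃ i j : ℕ, i < j ∧ j < M.K ∧ x = M.rho i j - (1 - 2 * q) ^ 2} = ∅ := by
      refine Set.eq_empty_of_forall_notMem ?_
      rintro x ⟨i, j, hij, hj, -⟩
      omega
    rw [ModelParams.eps, this, Real.sInf_empty]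
    exact zero_le_one

theorem one_add_pow_sub_one_le {N L : ℕ} (hN : 2 ≤ N) (hL : L ≤ 2 * N ^ 2) {y : ℝ} (hy0 : 0 ≤ y)
    (hy : y ≤ ((N : ℝ) ^ 4)⁻¹) : (1 + y) ^ L - 1 ≤ 4 * ((N : ℝ) ^ 2)⁻¹ := by
  have hN2 : (2 : ℝ) ≤ N := by exact_mod_cast hN
  have hN0 : (0 : ℝ) < N := by linarith
  have hL' : (L : ℝ) ≤ 2 * (N : ℝ) ^ 2 := by exact_mod_cast hL
  have hLy : L * y ≤ 2 * ((N : ℝ) ^ 2)⁻¹ := by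
    calc L * y ≤ (2 * (N : ℝ) ^ 2) * ((N : ℝ) ^ 4)⁻¹ := mul_le_mul hL' hy hy0 (by positivity)
      _ = 2 * ((N : ℝ) ^ 2)⁻¹ := by field_simp
  have hLy0 : 0 ≤ L * y := by positivity
  have h1 : 2 * ((N : ℝ) ^ 2)⁻¹ ≤ 1 := by
    rw [← div_eq_mul_inv, div_le_one (by positivity)]
    nlinarith
  have h2 : (1 + y) ^ L ≤ Real.exp (L * y) := by
    rw [Real.exp_nat_mul]
    exact pow_le_pow_left₀ (by linarith) (by linarith [Real.add_one_le_exp y]) L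
  have h3 := Real.abs_exp_sub_one_le (x := L * y) (by rw [abs_of_nonneg hLy0]; linarith)
  rw [abs_of_nonneg hLy0] at h3
  linarith [le_abs_self (Real.exp (L * y) - 1)]

end Limit

theorem mainTheorem2 {Ω : Type*} [MeasurableSpace Ω] (μ : Measure Ω) [IsProbabilityMeasure μ]
    (M : ℕ → ModelParams)
    (G : (N : ℕ) → Ω → SimpleGraph (Fin (M N).m))
    (H : (N : ℕ) → Ω → SimpleGraph (Fin (M N).n))
    (hGH : ∀ N, 1 ≤ N → IsCorrelatedBernoulli μ (M N) (G N) (H N))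
    (hN : ∀ N, 1 ≤ N → max (M N).m (M N).n = N)
    (q : ℝ) (hq0 : 0 < q) (hq1 : q < 1 / 2)
    (hp : ∀ N, 1 ≤ N → ∀ i j, i < j → j < N → (M N).p i j ∈ Set.Icc q (1 - q))
    (hrho : ∀ N, 1 ≤ N → ∀ i j, i < j → j < (M N).K → (1 - 2 * q) ^ 2 < (M N).rho i j)
    (heps : Tendsto (fun N : ℕ => ((M N).eps q) ^ 2 * ((M N).K : ℝ) / Real.log N) atTop atTop) :
    ∀ᵐ ω ∂μ, ∀ᶠ N : ℕ in atTop,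
      argMaxOn
        (fun PQ : Matrix (Fin (M N).m) (Fin (M N).n) ℝ × Matrix (Fin (M N).m) (Fin (M N).n) ℝ =>
          Matrix.trace (signedAdjMatrix (G N ω) * PQ.1 * signedAdjMatrix (H N ω) *
            PQ.2.transpose))
        (matchingMatrices (M N).m (M N).n (M N).K ×ˢ matchingMatrices (M N).m (M N).n (M N).K) =
      {(coreMatrix (M N).m (M N).n (M N).K, coreMatrix (M N).m (M N).n (M N).K)} := by
  -- `16384 = 4 * 4096` makes `exp(-ε²K/4096) ≤ N⁻⁴`, which beats the `2mn ≤ 2N²` matrix entries; `N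
  -- ≥ 2` keeps `log N` above `1/2`.
  obtain ⟨N₀, hN₀⟩ := eventually_atTop.mp
    ((heps.eventually_ge_atTop 16384).and (eventually_ge_atTop 2))
  let bad : ℕ → Set Ω := fun N => {ω | argMaxOn
        (fun PQ : Matrix (Fin (M N).m) (Fin (M N).n) ℝ × Matrix (Fin (M N).m) (Fin (M N).n) ℝ =>
          Matrix.trace (signedAdjMatrix (G N ω) * PQ.1 * signedAdjMatrix (H N ω) *
            PQ.2.transpose))
        (matchingMatrices (M N).m (M N).n (M N).K ×ˢ matchingMatrices (M N).m (M N).n (M N).K) ≠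
      {(coreMatrix (M N).m (M N).n (M N).K, coreMatrix (M N).m (M N).n (M N).K)}}
  have hbad : ∀ N, N₀ ≤ N → μ.real (bad N) ≤ 4 * ((N : ℝ) ^ 2)⁻¹ := by
    intro N hNN
    obtain ⟨h1, h2⟩ := hN₀ N hNN
    have hN1 : 1 ≤ N := by omega
    have hN0 : (0 : ℝ) < N := by exact_mod_cast hN1
    have hlog2 : Real.log 2 ≤ Real.log N :=
      Real.log_le_log zero_lt_two (by exact_mod_cast h2)
    have hlog : 1 / 2 < Real.log N := by linarith [Real.log_two_gt_d9]
    rw [le_div_iff₀ (by linarith)] at h1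
    have hε0 := (M N).eps_nonneg (hrho N hN1)
    have hε1 := (M N).eps_le_one (hrho N hN1)
    have hK0 : (0 : ℝ) ≤ (M N).K := Nat.cast_nonneg _
    have hεK : 12 ≤ (M N).eps q * (M N).K := by
      have : (M N).eps q ^ 2 * (M N).K ≤ (M N).eps q * (M N).K :=
        mul_le_mul_of_nonneg_right (by nlinarith) hK0
      linarith
    refine ((hGH N hN1).measureReal_argMaxOn_ne_le hq0 hq1
      (fun i j hij hj => hp N hN1 i j hij (by rwa [hN N hN1] at hj))
      (fun i j hij hj => (M N).eps_le (hrho N hN1) hij hj) hε0 hε1 hεK).trans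
      (one_add_pow_sub_one_le h2 ?_ (Real.exp_pos _).le ?_)
    · have hm : (M N).m ≤ N := (le_max_left _ _).trans (hN N hN1).le
      have hn : (M N).n ≤ N := (le_max_right _ _).trans (hN N hN1).le
      rw [pow_two]
      exact Nat.mul_le_mul_left 2 (Nat.mul_le_mul hm hn)
    · have h3 : ((N : ℝ) ^ 4)⁻¹ = Real.exp (-(4 * Real.log N)) := by
        rw [Real.exp_neg, show (4 : ℝ) = ((4 : ℕ) : ℝ) by norm_num, Real.exp_nat_mul,
          Real.exp_log hN0]
      rw [h3, Real.exp_le_exp]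
      linarith
  -- The finitely many indices below `N₀`, where no bound is available, are replaced by the empty
  -- event.
  have hsum : ∑' N, μ (if N₀ ≤ N then bad N else ∅) ≠ ⊤ := by
    have hs : Summable fun N : ℕ => 4 * ((N : ℝ) ^ 2)⁻¹ :=
      (Real.summable_nat_pow_inv.mpr one_lt_two).mul_left 4
    refine ne_top_of_le_ne_top hs.tsum_ofReal_ne_top (ENNReal.tsum_le_tsum fun N => ?_)
    split_ifs with h
    · rw [← ofReal_measureReal]
      exact ENNReal.ofReal_le_ofReal (hbad N h)
    · simp
  filter_upwards [ae_eventually_notMem hsum] with ω hω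
  filter_upwards [hω, eventually_ge_atTop N₀] with N h1 h2
  rw [if_pos h2] at h1
  exact not_not.mp h1
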